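/- **Setting.** Let $d\ge 2$ (in practice $d=2,3$). A *mesh* is a finite conforming triangulation $\mathcal K_h$ of a polytope in $\mathbb R^d$ into nondegenerate simplices $K$. $\mathcal E_h^I$ is the set of interior $(d-1)$-faces $e=\partial K_i\cap\partial K_j$; $n_e$ is the unit normal from $K_i$ to $K_j$; $[v]=v|_{K_i}-v|_{K_j}$, $\{v\}=\frac12(v|_{K_i}+v|_{K_j})$; $h_e=|e|$ is the $(d-1)$-dimensional measure of $e$. Inner products are $(\cdot,\cdot)=\sum_K\int_K$ and $\langle\cdot,\cdot\rangle_e=\int_e$. The discrete spaces are $\mathcal V_h$ (discontinuous piecewise affine vector fields), $\mathcal Q_h$ (piecewise constants) and $\mathcal U_h^0$ (lowest-order Raviart–Thomas fields in $H(\mathrm{div})$ with zero normal component on the boundary). *Fluid.* For $R,T,\beta>0$, $b\ge0$ let $$f(c)=cRT\ln c-cRT\ln(1-\beta c)+\frac{bc}{2\sqrt2\,\beta}\ln\frac{1+(1-\sqrt2)\beta c}{1+(1+\sqrt2)\beta c},\qquad \mu=f',\qquad p(c)=c\mu(c)-f(c).$$ For $0<\delta_1,\delta_2<1$ and $c\in\mathcal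 Q_h$ put $\chi_1=1-\delta_1(1-\beta c)^2$, $\chi_2=1+\delta_2(1-\beta c)^2$ and $$\theta(c)=\max_{K}\Big\{1,\ \tfrac{(1-\beta c)^2}{\chi_1(1-\chi_1\beta c)^2},\ \tfrac{(1-\beta c)^2}{\chi_2(1-\chi_2\beta c)^2}\Big\},$$ $$\mu[c,c']=\mu(c)+\theta(c)RT\,\frac{c'-c}{c(1-\beta c)^2},\qquad p[c,c']=c\,\mu[c,c']-f(c).$$ The mobility is $\lambda(\phi)=\frac{\kappa^0}{\nu}\big(\frac{\phi}{\phi_r}\big)^3\big(\frac{1-\phi_r}{1-\phi}\big)^2$, where $\kappa^0>0$ and $\phi_r\in(0,1)$ are given cell by cell and $\nu>0$. *Elasticity.* With $\varepsilon(v)=\frac12(\nabla v+\nabla v^T)$ and $\sigma_e(v)=2\eta\,\varepsilon(v)+\gamma(\nabla\cdot v)I$ let $$\begin{aligned}\mathcal A(u,p,v)=&\sum_K(\sigma_e(u),\varepsilon(v))_K-\sum_{e\in\mathcal E_h^I}\langle\{\sigma_e(u)n_e\},[v]\rangle_e-\alpha\sum_K(p,\nabla\cdot v)_K+\alpha\sum_{e\in\mathcal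 E_h^I}\langle\{p\,n_e\},[v]\rangle_e\\&-\sum_{e\in\mathcal E_h^I}\langle[u],\{\sigma_e(v)n_e\}\rangle_e+\sum_{e\in\mathcal E_h^I}\frac{\varsigma_2}{h_e}\langle[u],[v]\rangle_e .\end{aligned}$$ *Old time level.* Let $u_s^n\in\mathcal V_h$, $u_f^n\in\mathcal U_h^0$, $c^n,\phi^n,p^n\in\mathcal Q_h$ with $\varrho_0\le\beta c^n\le\varrho$, $C_{\phi,\min}\le\phi^n\le C_{\phi,\max}$ and $\mathcal A(u_s^n,p^n,v)=0$ for all $v\in\mathcal V_h$. The pressure $p^n$ is either $p(c^n)$ (initial level) or $p[c^{n-1},c^n]$ for the density $c^{n-1}\in\mathcal Q_h$ of the preceding level, where also $\varrho_0\le\beta c^{n-1}\le\varrho$. On $e$ the upwind value $c^{n*}$ is $c^n|_{K_i}$ if $u_f^n\cdot n_e\ge0$ and $c^n|_{K_j}$ otherwise. *Iteration.* Start from $\phi^{n+1,0}=\phi^n$ and any $u_f^{n+1,0}\in\mathcal U_h^0$. Given iterate $l$, let $\tau^l=\min_K\min(\tau_1,\tau_2,\tau_{\max})$ with $$\tau_1=\frac{\big(\phi^{n+1,l}c^n(1-\beta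 c^n)^2\delta_1-(\phi^{n+1,l}-\phi^n)c^n\big)|K|}{\sum_{e\subset\partial K,\ u_f^{n+1,l}\cdot n>0}c^{n*}u_f^{n+1,l}\cdot n\,|e|+\sum_{e\subset\partial K,\ [\mu(c^n)]>0}\frac{\varsigma_1}{h_e}[\mu(c^n)]|e|+\epsilon},$$ $$\tau_2=\frac{\big(\phi^{n+1,l}c^n(1-\beta c^n)^2\delta_2+(\phi^{n+1,l}-\phi^n)c^n\big)|K|}{-\Big(\sum_{e\subset\partial K,\ u_f^{n+1,l}\cdot n<0}c^{n*}u_f^{n+1,l}\cdot n\,|e|+\sum_{e\subset\partial K,\ [\mu(c^n)]<0}\frac{\varsigma_1}{h_e}[\mu(c^n)]|e|\Big)+\epsilon},$$ where the sums are over interior faces $e$ of $K$, $n$ is the outward normal of $K$, and $[\mu(c^n)]$ is the value in $K$ minus the value in the neighbour. Iterate $l+1$ consists of $u_s^{n+1,l+1}\in\mathcal V_h$, $u_f^{n+1,l+1}\in\mathcal U_h^0$, $c^{n+1,l+1},\phi^{n+1,l+1},p^{n+1,l+1}\in\mathcal Q_h$ such that, with $\mu^{n+1,l+1}=\mu[c^n,c^{n+1,l+1}]$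 and $D_\tau X^{n+1,l+1}=(X^{n+1,l+1}-X^n)/\tau^l$, for all $v\in\mathcal V_h$, $w\in\mathcal U_h^0$, $q,z,\varphi\in\mathcal Q_h$, $$\begin{aligned} &\mathcal A(u_s^{n+1,l+1},p^{n+1,l+1},v)=0,\\ &\Big(\tfrac{\phi^{n+1,l}c^{n+1,l+1}-\phi^nc^n}{\tau^l},q\Big)+\sum_{e\in\mathcal E_h^I}\langle c^{n*}u_f^{n+1,l}\cdot n_e,[q]\rangle_e+\sum_{e\in\mathcal E_h^I}\tfrac{\varsigma_1}{h_e}\langle[\mu^{n+1,l+1}],[q]\rangle_e=0,\\ &(\lambda^{-1}(\phi^n)u_f^{n+1,l+1},w)=\sum_{e\in\mathcal E_h^I}\langle[\mu^{n+1,l+1}],c^{n*}w\cdot n_e\rangle_e,\\ &(p^{n+1,l+1},z)=(c^n\mu^{n+1,l+1}-f(c^n),z),\\ &(D_\tau\phi^{n+1,l+1},\varphi)=\tfrac1N(D_\tau p^{n+1,l+1},\varphi)+\alpha(\nabla\cdot D_\tau u_s^{n+1,l+1},\varphi)-\alpha\sum_{e\in\mathcal E_h^I}\langle\{\varphi n_e\},[D_\tau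 u_s^{n+1,l+1}]\rangle_e . \end{aligned}$$ **Theorem.** Let $\alpha,\eta>0$, $0<\delta_1,\delta_2<1$, $0<\varrho_0$, $\varrho<1$, $0<C_{\phi,\min}$, $C_{\phi,\max}<1$, and let $C_\epsilon$ satisfy $$0<C_\epsilon<\min\Big(\frac{(1-\varrho)^2\delta_2C_{\phi,\min}}{1+(1-\varrho)^2\delta_2},\ \frac{(1-\varrho)^2\delta_1C_{\phi,\min}}{1-(1-\varrho)^2\delta_1},\ 1-C_{\phi,\max}\Big).$$ Then there is $N_0>0$, depending only on $d$, the fluid and the constants just listed, and for every mesh there are $\gamma_0,\kappa>0$, depending only on these data and the mesh, such that the following holds whenever $N\ge N_0$, $\gamma\ge\gamma_0$ and $\varsigma_2\ge\kappa\gamma$, for all $\varsigma_1,\epsilon,\tau_{\max}>0$ and all $\kappa^0,\phi_r,\nu$ as above. For every old time level and every sequence of iterates as above, for every $l\ge0$ for which the iterates up to $l+1$ are defined, on every cell, $$0<\phi^n-C_\epsilon\le\phi^{n+1,l+1}\le\phi^n+C_\epsilon<1,$$ $$\frac1{1+(1-\beta c^n)^2\delta_2}<\frac{\phi^{n+1,l}}{\phi^n}<\frac1{1-(1-\beta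 c^n)^2\delta_1},$$ $$0<\big(1-\delta_1(1-\beta c^n)^2\big)c^n\le c^{n+1,l+1}\le\big(1+\delta_2(1-\beta c^n)^2\big)c^n<\frac1\beta .$$ -/

import Mathlib

open MeasureTheory

namespace PoroFlow

/-! ### Peng-Robinson fluid -/

/-- Constants of a Peng-Robinson fluid at a fixed temperature: gas constant `R`, temperature `T`,
attraction parameter `b = b(T)` and covolume parameter `β`. -/
structure Fluid where
  R : ℝ
  T : ℝ
  b : ℝ
  β : ℝ
  R_pos : 0 < R
  T_pos : 0 < T
  b_nonneg : 0 ≤ b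
  β_pos : 0 < β

namespace Fluid

/-- Helmholtz free energy density `f = f_ide + f_rep + f_att`. -/
noncomputable def helmholtz (F : Fluid) (c : ℝ) : ℝ :=
  c * F.R * F.T * Real.log c
    + -(c * F.R * F.T * Real.log (1 - F.β * c))
    + F.b * c / (2 * Real.sqrt 2 * F.β) *
        Real.log ((1 + (1 - Real.sqrt 2) * F.β * c) / (1 + (1 + Real.sqrt 2) * F.β * c))

/-- Chemical potential `μ = f'`. -/
noncomputable def chemPot (F : Fluid) (c : ℝ) : ℝ := deriv F.helmholtz c

/-- Pressure of the equation of state, `p(c) = c μ(c) - f(c)`. -/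
noncomputable def pressure (F : Fluid) (c : ℝ) : ℝ := c * F.chemPot c - F.helmholtz c

/-- Stabilization variable `ζ = (c' - c) / (c (1 - β c)²)`; `c` is the old and `c'` the new
molar density. -/
noncomputable def zeta (F : Fluid) (c c' : ℝ) : ℝ := (c' - c) / (c * (1 - F.β * c) ^ 2)

/-- Stabilized chemical potential `μ(c) + θ R T ζ`. -/
noncomputable def stabPot (F : Fluid) (θ c c' : ℝ) : ℝ :=
  F.chemPot c + θ * F.R * F.T * F.zeta c c'

/-- Stabilized pressure `c (μ(c) + θ R T ζ) - f(c)`. -/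
noncomputable def stabPressure (F : Fluid) (θ c c' : ℝ) : ℝ :=
  c * F.stabPot θ c c' - F.helmholtz c

end Fluid

/-! ### Simplicial meshes -/

/-- A finite conforming triangulation of a polytope in `ℝ^d`: a finite pure `d`-dimensional
simplicial complex. Its cells are the `d`-simplices, its faces are the `(d-1)`-simplices, and an
interior face is one that lies in two different cells. The two cells of an interior face are
numbered (`fst`, `snd`), which fixes the orientation of the face, from `fst` to `snd`. Simplices are
given by their vertex sets; the associated closed set is the convex hull. -/
structure Mesh (d : ℕ) where
  complex : Geometry.SimplicialComplex ℝ (EuclideanSpace ℝ (Fin d))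
  finite_faces : complex.faces.Finite
  nonempty_faces : complex.faces.Nonempty
  pure : ∀ s ∈ complex.faces, ∃ t ∈ complex.faces, s ⊆ t ∧ t.card = d + 1
  fst : {e : Finset (EuclideanSpace ℝ (Fin d)) // e ∈ complex.faces ∧ e.card = d ∧
      ∃ K ∈ complex.faces, ∃ L ∈ complex.faces, K.card = d + 1 ∧ L.card = d + 1 ∧ K ≠ L ∧
        e ⊆ K ∧ e ⊆ L} →
    {K : Finset (EuclideanSpace ℝ (Fin d)) // K ∈ complex.faces ∧ K.card = d + 1}
  snd : {e : Finset (EuclideanSpace ℝ (Fin d)) // e ∈ complex.faces ∧ e.card = d ∧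
      ∃ K ∈ complex.faces, ∃ L ∈ complex.faces, K.card = d + 1 ∧ L.card = d + 1 ∧ K ≠ L ∧
        e ⊆ K ∧ e ⊆ L} →
    {K : Finset (EuclideanSpace ℝ (Fin d)) // K ∈ complex.faces ∧ K.card = d + 1}
  fst_ne_snd : ∀ e, fst e ≠ snd e
  subset_fst : ∀ e, e.1 ⊆ (fst e).1
  subset_snd : ∀ e, e.1 ⊆ (snd e).1

namespace Mesh

variable {d : ℕ} (M : Mesh d)

/-- The cells (elements) of the mesh. -/
abbrev Cell : Type :=
  {K : Finset (EuclideanSpace ℝ (Fin d)) // K ∈ M.complex.faces ∧ K.card = d + 1}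

/-- The interior faces of the mesh. -/
abbrev IFace : Type :=
  {e : Finset (EuclideanSpace ℝ (Fin d)) // e ∈ M.complex.faces ∧ e.card = d ∧
      ∃ K ∈ M.complex.faces, ∃ L ∈ M.complex.faces, K.card = d + 1 ∧ L.card = d + 1 ∧ K ≠ L ∧
        e ⊆ K ∧ e ⊆ L}

noncomputable instance : Fintype M.Cell :=
  @Fintype.ofFinite _ ((M.finite_faces.subset (fun _ h => h.1)).to_subtype)

noncomputable instance : Fintype M.IFace :=
  @Fintype.ofFinite _ ((M.finite_faces.subset (fun _ h => h.1)).to_subtype)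

instance : Nonempty M.Cell := by
  obtain ⟨s, hs⟩ := M.nonempty_faces
  obtain ⟨t, ht, -, hc⟩ := M.pure s hs
  exact ⟨⟨t, ht, hc⟩⟩

/-- The closed simplex occupied by a cell. -/
def cellSet (K : M.Cell) : Set (EuclideanSpace ℝ (Fin d)) := convexHull ℝ (K.1 : Set _)

/-- The closed `(d-1)`-simplex occupied by an interior face. -/
def faceSet (e : M.IFace) : Set (EuclideanSpace ℝ (Fin d)) := convexHull ℝ (e.1 : Set _)

/-- `|K|`. -/
noncomputable def vol (K : M.Cell) : ℝ := volume.real (M.cellSet K)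

/-- `|e|`: length of an edge for `d = 2`, area of a face for `d = 3`. The mesh parameter `h_e` in
the penalty terms is this same number. -/
noncomputable def area (e : M.IFace) : ℝ := (μHE[d - 1]).real (M.faceSet e)

/-- Outward unit normal on the face `e` of the simplex `K`: the component orthogonal to `e` of the
vector from the barycentre of `K` to the barycentre of `e`, normalized. -/
noncomputable def outNormal (K e : Finset (EuclideanSpace ℝ (Fin d))) :
    EuclideanSpace ℝ (Fin d) :=
  let v := (vectorSpan ℝ (e : Set (EuclideanSpace ℝ (Fin d))))ᗮ.starProjection
    (e.centroid ℝ id -ᵥ K.centroid ℝ id)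
  ‖v‖⁻¹ • v

/-- The unit normal `n_e` of an interior face, pointing from `fst e` to `snd e`. -/
noncomputable def normal (e : M.IFace) : EuclideanSpace ℝ (Fin d) :=
  outNormal (M.fst e).1 e.1

/-! ### Discrete spaces -/

/-- `Q_h`: piecewise constant functions, given by their cell values. -/
abbrev Q : Type := M.Cell → ℝ

/-- `V_h`: discontinuous piecewise affine vector fields. -/
abbrev V : Type :=
  M.Cell → (EuclideanSpace ℝ (Fin d) →ᵃ[ℝ] EuclideanSpace ℝ (Fin d))

/-- Fields of the form `a_K + s_K x` on each cell `K` (discontinuous lowest-order Raviart-Thomas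
fields), given by the pairs `(a_K, s_K)`. -/
abbrev RT : Type := M.Cell → EuclideanSpace ℝ (Fin d) × ℝ

variable {M}

/-- Value at `x` of the restriction of a Raviart-Thomas field to the cell `K`. -/
noncomputable def rtVal (w : M.RT) (K : M.Cell) (x : EuclideanSpace ℝ (Fin d)) :
    EuclideanSpace ℝ (Fin d) := (w K).1 + (w K).2 • x

/-- `U_h⁰`: the piecewise Raviart-Thomas fields that lie in `H(div)`, i.e. whose normal components
agree from both sides of each interior face, and whose normal component vanishes on the boundary,
i.e. on each face that lies in one cell only. -/
def IsRT0 (w : M.RT) : Prop :=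
  (∀ e : M.IFace, ∀ x ∈ M.faceSet e,
    inner ℝ (rtVal w (M.fst e) x) (M.normal e) = inner ℝ (rtVal w (M.snd e) x) (M.normal e)) ∧
  (∀ (K : M.Cell) (e : Finset (EuclideanSpace ℝ (Fin d))), e ⊆ K.1 → e.card = d →
    (∀ L : M.Cell, e ⊆ L.1 → L = K) →
    ∀ x ∈ convexHull ℝ (e : Set (EuclideanSpace ℝ (Fin d))),
      inner ℝ (rtVal w K x) (outNormal K.1 e) = 0)

/-- Jump `[q]` of a piecewise constant function across an interior face. -/
def jumpQ (q : M.Q) (e : M.IFace) : ℝ := q (M.fst e) - q (M.snd e)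

/-- Average `{q}` of a piecewise constant function on an interior face. -/
noncomputable def avgQ (q : M.Q) (e : M.IFace) : ℝ := (1 / 2) * (q (M.fst e) + q (M.snd e))

/-- Jump `[v]` of a piecewise affine vector field at a point of an interior face. -/
noncomputable def jumpV (v : M.V) (e : M.IFace) (x : EuclideanSpace ℝ (Fin d)) :
    EuclideanSpace ℝ (Fin d) := v (M.fst e) x - v (M.snd e) x

/-- `L²` inner product of piecewise constant functions. -/
noncomputable def innerQ (q r : M.Q) : ℝ :=
  ∑ K : M.Cell, ∫ _x in M.cellSet K, q K * r K

/-- Gradient of `v` on the cell `K`, the (constant) matrix `(∂_j v_i)`. -/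
noncomputable def grad (v : M.V) (K : M.Cell) : Matrix (Fin d) (Fin d) ℝ :=
  Matrix.of fun i j => (v K).linear (EuclideanSpace.single j 1) i

/-- Divergence of `v` on the cell `K`. -/
noncomputable def dvg (v : M.V) (K : M.Cell) : ℝ := (grad v K).trace

/-- Strain `ε(v) = (∇v + ∇vᵀ) / 2` on the cell `K`. -/
noncomputable def strain (v : M.V) (K : M.Cell) : Matrix (Fin d) (Fin d) ℝ :=
  (1 / 2 : ℝ) • (grad v K + (grad v K).transpose)

/-- Effective stress `σ_e(v) = 2 η ε(v) + γ (div v) I` on the cell `K`. -/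
noncomputable def stress (η γ : ℝ) (v : M.V) (K : M.Cell) : Matrix (Fin d) (Fin d) ℝ :=
  (2 * η) • strain v K + (γ * dvg v K) • (1 : Matrix (Fin d) (Fin d) ℝ)

/-- Averaged traction `{σ_e(v) n_e}` on an interior face. -/
noncomputable def traction (η γ : ℝ) (v : M.V) (e : M.IFace) : EuclideanSpace ℝ (Fin d) :=
  (1 / 2 : ℝ) • (WithLp.toLp 2 ((stress η γ v (M.fst e)).mulVec (M.normal e).ofLp)
    + WithLp.toLp 2 ((stress η γ v (M.snd e)).mulVec (M.normal e).ofLp))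

/-- The interior penalty form `𝒜(u, p, v)` of the poroelasticity equation. -/
noncomputable def formA (α η γ ς₂ : ℝ) (u : M.V) (p : M.Q) (v : M.V) : ℝ :=
  (∑ K : M.Cell, ∫ _x in M.cellSet K, ∑ i, ∑ j, stress η γ u K i j * strain v K i j)
  - (∑ e : M.IFace, ∫ x in M.faceSet e, inner ℝ (traction η γ u e) (jumpV v e x) ∂μHE[d - 1])
  - α * (∑ K : M.Cell, ∫ _x in M.cellSet K, p K * dvg v K)
  + α * (∑ e : M.IFace, ∫ x in M.faceSet e,
      inner ℝ (avgQ p e • M.normal e) (jumpV v e x) ∂μHE[d - 1])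
  - (∑ e : M.IFace, ∫ x in M.faceSet e, inner ℝ (jumpV u e x) (traction η γ v e) ∂μHE[d - 1])
  + (∑ e : M.IFace, ς₂ / M.area e *
      ∫ x in M.faceSet e, inner ℝ (jumpV u e x) (jumpV v e x) ∂μHE[d - 1])

/-- `∫_e w · n_e`. As the normal component of a Raviart-Thomas field is constant on a face, this
is `(w · n_e) |e|`. -/
noncomputable def flux (w : M.RT) (e : M.IFace) : ℝ :=
  ∫ x in M.faceSet e, inner ℝ (rtVal w (M.fst e) x) (M.normal e) ∂μHE[d - 1]

/-- Upwind value on an interior face of the piecewise constant `c`, for the velocity `w`. -/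
noncomputable def upwind (w : M.RT) (c : M.Q) (e : M.IFace) : ℝ :=
  open Classical in if 0 ≤ flux w e then c (M.fst e) else c (M.snd e)

/-- `1` if the normal `n_e` is outward for `K`, `-1` if it is inward, `0` if `e` is not a face
of `K`. -/
noncomputable def sgn (K : M.Cell) (e : M.IFace) : ℝ :=
  open Classical in if M.fst e = K then 1 else if M.snd e = K then -1 else 0

/-! ### The scheme -/

/-- Stabilization parameter
`θ = max_K {1, (1-βc)²/(χ₁(1-χ₁βc)²), (1-βc)²/(χ₂(1-χ₂βc)²)}` with `χ₁ = 1 - δ₁(1-βc)²` and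
`χ₂ = 1 + δ₂(1-βc)²`. -/
noncomputable def theta (F : Fluid) (δ₁ δ₂ : ℝ) (c : M.Q) : ℝ :=
  ⨆ K : M.Cell,
    let y := F.β * c K
    let χ₁ := 1 - δ₁ * (1 - y) ^ 2
    let χ₂ := 1 + δ₂ * (1 - y) ^ 2
    max 1 (max ((1 - y) ^ 2 / (χ₁ * (1 - χ₁ * y) ^ 2)) ((1 - y) ^ 2 / (χ₂ * (1 - χ₂ * y) ^ 2)))

/-- Kozeny-Carman mobility `λ(φ) = κ⁰ (φ/φ_r)³ ((1-φ_r)/(1-φ))² / ν`. -/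
noncomputable def mobility (κ₀ φr ν φ : ℝ) : ℝ :=
  κ₀ * (φ / φr) ^ 3 * ((1 - φr) / (1 - φ)) ^ 2 / ν

variable (M) in
/-- The discrete unknowns: displacement, fluid velocity, molar density, porosity and pressure. -/
structure State where
  us : M.V
  uf : M.RT
  c : M.Q
  φ : M.Q
  p : M.Q

/-- The data of the scheme: fluid, Biot coefficient `α`, Lamé parameters `η`, `γ`, Biot modulus `N`,
penalty parameters `ς₁`, `ς₂`, intrinsic permeability `κ₀` and reference porosity `φr` (cell by
cell), viscosity `ν`, and the constants `δ₁`, `δ₂`, `ε`, `τmax` of the adaptive time step. -/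
structure Data (M : Mesh d) where
  F : Fluid
  α : ℝ
  η : ℝ
  γ : ℝ
  N : ℝ
  ς₁ : ℝ
  ς₂ : ℝ
  κ₀ : M.Q
  φr : M.Q
  ν : ℝ
  δ₁ : ℝ
  δ₂ : ℝ
  ε : ℝ
  τmax : ℝ

/-- Adaptive time step: the minimum over all cells of `τ₁`, `τ₂`, `τmax`. Here `s` is the state at
the old time level and `φ`, `uf` are the current iterates of porosity and velocity; for a face `e`
of a cell `K`, `sgn K e * flux uf e` is `(uf · n) |e|` and `sgn K e * jumpQ μ e` is `[μ]`, both with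
respect to the outward normal of `K`. -/
noncomputable def timeStep (D : Data M) (s : State M) (φ : M.Q) (uf : M.RT) : ℝ :=
  open Classical in
  let μ : M.Q := fun K => D.F.chemPot (s.c K)
  let τ₁ : M.Cell → ℝ := fun K =>
    ((φ K * s.c K * (1 - D.F.β * s.c K) ^ 2 * D.δ₁ - (φ K - s.φ K) * s.c K) * M.vol K) /
      ((∑ e : M.IFace with 0 < sgn K e * flux uf e,
          upwind s.uf s.c e * (sgn K e * flux uf e))
        + (∑ e : M.IFace with 0 < sgn K e * jumpQ μ e,
          D.ς₁ / M.area e * (sgn K e * jumpQ μ e) * M.area e) + D.ε)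
  let τ₂ : M.Cell → ℝ := fun K =>
    ((φ K * s.c K * (1 - D.F.β * s.c K) ^ 2 * D.δ₂ + (φ K - s.φ K) * s.c K) * M.vol K) /
      (-((∑ e : M.IFace with sgn K e * flux uf e < 0,
          upwind s.uf s.c e * (sgn K e * flux uf e))
        + (∑ e : M.IFace with sgn K e * jumpQ μ e < 0,
          D.ς₁ / M.area e * (sgn K e * jumpQ μ e) * M.area e)) + D.ε)
  ⨅ K : M.Cell, min (τ₁ K) (min (τ₂ K) D.τmax)

/-- One step of the linear iteration, from the iterate `a` to the iterate `a'`, where `s` is the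
state at the old time level and the time step is computed from `a`. -/
structure IsIteration (D : Data M) (s a a' : State M) : Prop where
  velocity_mem : IsRT0 a'.uf
  /-- momentum balance of the solid -/
  momentum : ∀ v : M.V, formA D.α D.η D.γ D.ς₂ a'.us a'.p v = 0
  /-- mass balance of the gas -/
  mass : ∀ q : M.Q,
    innerQ (fun K => (a.φ K * a'.c K - s.φ K * s.c K) / timeStep D s a.φ a.uf) q
      + (∑ e : M.IFace, ∫ x in M.faceSet e,
          upwind s.uf s.c e * inner ℝ (rtVal a.uf (M.fst e) x) (M.normal e) * jumpQ q e ∂μHE[d - 1])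
      + (∑ e : M.IFace, D.ς₁ / M.area e * ∫ _x in M.faceSet e,
          jumpQ (fun K => D.F.stabPot (theta D.F D.δ₁ D.δ₂ s.c) (s.c K) (a'.c K)) e * jumpQ q e
            ∂μHE[d - 1]) = 0
  /-- Darcy law -/
  darcy : ∀ w : M.RT, IsRT0 w →
    (∑ K : M.Cell, ∫ x in M.cellSet K,
        (mobility (D.κ₀ K) (D.φr K) D.ν (s.φ K))⁻¹ * inner ℝ (rtVal a'.uf K x) (rtVal w K x))
      = ∑ e : M.IFace, ∫ x in M.faceSet e,
          jumpQ (fun K => D.F.stabPot (theta D.F D.δ₁ D.δ₂ s.c) (s.c K) (a'.c K)) e *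
            (upwind s.uf s.c e * inner ℝ (rtVal w (M.fst e) x) (M.normal e)) ∂μHE[d - 1]
  /-- pressure -/
  pressure : ∀ z : M.Q, innerQ a'.p z =
    innerQ (fun K => D.F.stabPressure (theta D.F D.δ₁ D.δ₂ s.c) (s.c K) (a'.c K)) z
  /-- porosity -/
  porosity : ∀ ψ : M.Q,
    innerQ (fun K => (a'.φ K - s.φ K) / timeStep D s a.φ a.uf) ψ
      = 1 / D.N * innerQ (fun K => (a'.p K - s.p K) / timeStep D s a.φ a.uf) ψ
        + D.α * innerQ (dvg ((timeStep D s a.φ a.uf)⁻¹ • (a'.us - s.us))) ψ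
        - D.α * ∑ e : M.IFace, ∫ x in M.faceSet e,
            inner ℝ (avgQ ψ e • M.normal e)
              (jumpV ((timeStep D s a.φ a.uf)⁻¹ • (a'.us - s.us)) e x) ∂μHE[d - 1]

/-- `ϱ₀ ≤ β c ≤ ϱ` on all cells. -/
def DensityRange (F : Fluid) (ϱ₀ ϱ : ℝ) (c : M.Q) : Prop :=
  ∀ K, ϱ₀ ≤ F.β * c K ∧ F.β * c K ≤ ϱ

/-- The state `s` is a time level of the scheme: the velocity is in `U_h⁰`, displacement and
pressure satisfy the momentum balance, and the pressure is either the initial one, `p(c)`, or the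
stabilized one obtained from the molar density `c₀` of the preceding time level, which obeys the
same density bounds. -/
structure IsTimeLevel (D : Data M) (ϱ₀ ϱ : ℝ) (s : State M) : Prop where
  velocity_mem : IsRT0 s.uf
  momentum : ∀ v : M.V, formA D.α D.η D.γ D.ς₂ s.us s.p v = 0
  pressure : (∀ K, s.p K = D.F.pressure (s.c K)) ∨
    ∃ c₀ : M.Q, DensityRange D.F ϱ₀ ϱ c₀ ∧
      ∀ K, s.p K = D.F.stabPressure (theta D.F D.δ₁ D.δ₂ c₀) (c₀ K) (s.c K)

end Mesh

end PoroFlow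

/-! The property carried through the iteration is that every porosity iterate lies within Cε of the
old porosity. The bounds on Cε turn it into the ratio bounds (`ratio_bounds`). These say exactly
that the numerators of τ₁ and τ₂ are positive, so the time step is positive and limits the in- and
outflow of each cell (`timeStep_spec`). Written for ζ, the linear correction in the stabilized
potential, the mass balance is a discrete diffusion problem whose explicit part is the net outflow.
At a cell where ζ is extremal the diffusion term has a sign, and the limit on the outflow leaves -δ₁
≤ ζ ≤ δ₂ (`IsIteration.zeta_bounds`), which is the density bound.

To close the induction, bounded ζ and bounded θ give a pressure bound P independent of the mesh, N
and γ. Hence the pressure part of the porosity increment is small for large N. The displacement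
enters the porosity only through its divergences and jumps, so no Korn inequality is needed. The
momentum balances of the two levels are subtracted and tested with the displacement increment. The
penalty form dominates γ times the squares of divergences and jumps (`exists_penalty_coercive`),
whereas the pressure coupling is linear in them, so they are O(1/γ) (`brokenL1_le_of_momentum`).
Each of the two contributions is allotted half of Cε. -/

namespace PoroFlow

namespace Mesh

variable {d : ℕ} {M : Mesh d}

/-! ### Measures of cells and faces, cell indicators -/

theorem isCompact_cellSet (K : M.Cell) : IsCompact (M.cellSet K) :=
  K.1.finite_toSet.isCompact_convexHull ℝ

theorem isCompact_faceSet (e : M.IFace) : IsCompact (M.faceSet e) :=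
  e.1.finite_toSet.isCompact_convexHull ℝ

theorem vol_pos (K : M.Cell) : 0 < M.vol K := by
  have hind := M.complex.indep K.2.1
  have htop : affineSpan ℝ (K.1 : Set (EuclideanSpace ℝ (Fin d))) = ⊤ := by
    have h := hind.affineSpan_eq_top_iff_card_eq_finrank_add_one
    rw [Subtype.range_coe_subtype] at h
    refine h.2 ?_
    simpa using K.2.2
  have hint : (interior (M.cellSet K)).Nonempty := by
    rw [cellSet, interior_convexHull_nonempty_iff_affineSpan_eq_top]
    exact htop
  refine ENNReal.toReal_pos ?_ (isCompact_cellSet K).measure_lt_top.ne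
  exact (Measure.measure_pos_of_nonempty_interior _ hint).ne'

theorem area_nonneg (e : M.IFace) : 0 ≤ M.area e := ENNReal.toReal_nonneg

/-- Translation by a vertex embeds the (d-1)-dimensional direction space of the face isometrically.
There the Hausdorff measure is Lebesgue measure, and the preimage of the face is compact. Finiteness
makes continuous functions integrable on faces and `M.area` the true measure. -/
theorem faceSet_measure_lt_top (e : M.IFace) : μHE[d - 1] (M.faceSet e) < ⊤ := by
  obtain ⟨p, hp⟩ := M.complex.nonempty_of_mem_faces e.2.1
  have hind := M.complex.indep e.2.1
  set W := vectorSpan ℝ (e.1 : Set (EuclideanSpace ℝ (Fin d))) with hW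
  have hrank : Module.finrank ℝ W = d - 1 := by
    have hd : 0 < e.1.card := Finset.card_pos.2 ⟨p, hp⟩
    have h := hind.finrank_vectorSpan (n := d - 1) (by
      have := e.2.2.1
      simp only [Fintype.card_coe]; omega)
    rw [Subtype.range_coe_subtype] at h
    exact h
  let f : W → EuclideanSpace ℝ (Fin d) := fun v => (v : EuclideanSpace ℝ (Fin d)) + p
  have hf : Isometry f := fun x y => by simp [f, Subtype.edist_eq]
  have hsub : M.faceSet e ⊆ f '' (f ⁻¹' M.faceSet e) := by
    intro x hx
    have hx' : x ∈ affineSpan ℝ (e.1 : Set (EuclideanSpace ℝ (Fin d))) :=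
      convexHull_subset_affineSpan _ hx
    have hv : x -ᵥ p ∈ W := by
      rw [hW, ← direction_affineSpan]
      exact AffineSubspace.vsub_mem_direction hx' (subset_affineSpan ℝ _ hp)
    have hfx : f ⟨x -ᵥ p, hv⟩ = x := by simp [f]
    exact ⟨⟨x -ᵥ p, hv⟩, by rw [Set.mem_preimage, hfx]; exact hx, hfx⟩
  have hcomp : IsCompact (f ⁻¹' M.faceSet e) :=
    hf.isClosedEmbedding.isCompact_preimage (isCompact_faceSet e)
  calc μHE[d - 1] (M.faceSet e) ≤ μHE[d - 1] (f '' (f ⁻¹' M.faceSet e)) := measure_mono hsub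
    _ = μHE[d - 1] (f ⁻¹' M.faceSet e) := hf.euclideanHausdorffMeasure_image _
    _ = volume (f ⁻¹' M.faceSet e) := by
        rw [← hrank, InnerProductSpace.euclideanHausdorffMeasure_eq_volume]
    _ < ⊤ := hcomp.measure_lt_top

instance isFiniteMeasure_restrict_faceSet (e : M.IFace) :
    IsFiniteMeasure ((μHE[d - 1]).restrict (M.faceSet e)) :=
  ⟨by simpa using faceSet_measure_lt_top e⟩

theorem integrable_faceSet {E : Type*} [NormedAddCommGroup E] (e : M.IFace)
    {g : EuclideanSpace ℝ (Fin d) → E} (hg : Continuous g) [SecondCountableTopology E] :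
    Integrable g ((μHE[d - 1]).restrict (M.faceSet e)) := by
  obtain ⟨C, hC⟩ := (isCompact_faceSet e).exists_bound_of_continuousOn hg.continuousOn
  refine Integrable.of_bound hg.aestronglyMeasurable C ?_
  exact (ae_restrict_iff' (isCompact_faceSet e).measurableSet).2 (Filter.Eventually.of_forall hC)

theorem continuous_jumpV (v : M.V) (e : M.IFace) : Continuous (jumpV v e) :=
  (v (M.fst e)).continuous_of_finiteDimensional.sub
    (v (M.snd e)).continuous_of_finiteDimensional

theorem norm_normal_le (e : M.IFace) : ‖M.normal e‖ ≤ 1 := by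
  simp only [normal, outNormal, norm_smul, norm_inv, norm_norm]
  exact inv_mul_le_one

theorem setIntegral_cell_const (K : M.Cell) (r : ℝ) : ∫ _x in M.cellSet K, r = M.vol K * r := by
  rw [setIntegral_const, smul_eq_mul]; rfl

theorem setIntegral_face_const (e : M.IFace) (r : ℝ) :
    ∫ _x in M.faceSet e, r ∂μHE[d - 1] = M.area e * r := by
  rw [setIntegral_const, smul_eq_mul]; rfl

/-- The indicator of a cell, a test function of `Q_h`. -/
noncomputable def cellInd (K : M.Cell) : M.Q := open Classical in Pi.single K 1

theorem innerQ_cellInd (q : M.Q) (K : M.Cell) : innerQ q (cellInd K) = M.vol K * q K := by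
  classical
  simp only [innerQ, setIntegral_cell_const, cellInd]
  rw [Finset.sum_eq_single K]
  · simp
  · intro L _ hL; simp [hL]
  · simp

theorem jumpQ_cellInd (K : M.Cell) (e : M.IFace) : jumpQ (cellInd K) e = sgn K e := by
  classical
  have hne := M.fst_ne_snd e
  unfold jumpQ cellInd sgn
  by_cases h1 : M.fst e = K
  · have : M.snd e ≠ K := fun h => hne (h1.trans h.symm)
    simp [h1, this]
  · by_cases h2 : M.snd e = K
    · simp [h1, h2]
    · simp [h1, h2]

theorem abs_avgQ_le {q : M.Q} {P : ℝ} (h : ∀ K, |q K| ≤ P) (e : M.IFace) : |avgQ q e| ≤ P := by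
  have h1 := abs_le.1 (h (M.fst e)); have h2 := abs_le.1 (h (M.snd e))
  unfold avgQ; rw [abs_le]; constructor <;> linarith

theorem abs_cellInd_le (K L : M.Cell) : |cellInd K L| ≤ 1 := by
  classical
  unfold cellInd; by_cases h : L = K <;> simp [h]

/-! ### Linearity of the discrete operators and the divergence pairing -/

theorem grad_sub (u v : M.V) (K : M.Cell) : grad (u - v) K = grad u K - grad v K := by
  ext i j; simp [grad]

theorem grad_smul (r : ℝ) (v : M.V) (K : M.Cell) : grad (r • v) K = r • grad v K := by
  ext i j; simp [grad]

theorem dvg_sub (u v : M.V) (K : M.Cell) : dvg (u - v) K = dvg u K - dvg v K := by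
  simp [dvg, grad_sub]

theorem dvg_smul (r : ℝ) (v : M.V) (K : M.Cell) : dvg (r • v) K = r * dvg v K := by
  simp [dvg, grad_smul]

theorem strain_sub (u v : M.V) (K : M.Cell) : strain (u - v) K = strain u K - strain v K := by
  simp only [strain, grad_sub, Matrix.transpose_sub]; module

theorem stress_sub (η γ : ℝ) (u v : M.V) (K : M.Cell) :
    stress η γ (u - v) K = stress η γ u K - stress η γ v K := by
  simp only [stress, strain_sub, dvg_sub]; module

theorem traction_sub (η γ : ℝ) (u v : M.V) (e : M.IFace) :
    traction η γ (u - v) e = traction η γ u e - traction η γ v e := by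
  simp only [traction, stress_sub, Matrix.sub_mulVec, WithLp.toLp_sub]; module

theorem jumpV_sub (u v : M.V) (e : M.IFace) (x : EuclideanSpace ℝ (Fin d)) :
    jumpV (u - v) e x = jumpV u e x - jumpV v e x := by
  simp only [jumpV, Pi.sub_apply, AffineMap.coe_sub]; abel

theorem jumpV_smul (r : ℝ) (v : M.V) (e : M.IFace) (x : EuclideanSpace ℝ (Fin d)) :
    jumpV (r • v) e x = r • jumpV v e x := by
  simp only [jumpV, Pi.smul_apply, AffineMap.coe_smul]; module

theorem avgQ_sub (p q : M.Q) (e : M.IFace) : avgQ (p - q) e = avgQ p e - avgQ q e := by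
  simp only [avgQ, Pi.sub_apply]; ring

theorem integral_inner_left_sub (e : M.IFace) (t₁ t₂ : EuclideanSpace ℝ (Fin d)) (v : M.V) :
    ∫ x in M.faceSet e, inner ℝ (t₁ - t₂) (jumpV v e x) ∂μHE[d - 1]
      = (∫ x in M.faceSet e, inner ℝ t₁ (jumpV v e x) ∂μHE[d - 1])
        - ∫ x in M.faceSet e, inner ℝ t₂ (jumpV v e x) ∂μHE[d - 1] := by
  have hc := continuous_jumpV v e
  simp only [inner_sub_left]
  exact integral_sub (integrable_faceSet e (by fun_prop)) (integrable_faceSet e (by fun_prop))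

theorem integral_inner_jumpV_sub (e : M.IFace) (u v : M.V)
    {g : EuclideanSpace ℝ (Fin d) → EuclideanSpace ℝ (Fin d)} (hg : Continuous g) :
    ∫ x in M.faceSet e, inner ℝ (jumpV (u - v) e x) (g x) ∂μHE[d - 1]
      = (∫ x in M.faceSet e, inner ℝ (jumpV u e x) (g x) ∂μHE[d - 1])
        - ∫ x in M.faceSet e, inner ℝ (jumpV v e x) (g x) ∂μHE[d - 1] := by
  have hu := continuous_jumpV u e
  have hv := continuous_jumpV v e
  simp only [jumpV_sub, inner_sub_left]
  exact integral_sub (integrable_faceSet e (by fun_prop)) (integrable_faceSet e (by fun_prop))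

theorem formA_sub (α η γ ς₂ : ℝ) (u u' : M.V) (p p' : M.Q) (v : M.V) :
    formA α η γ ς₂ (u' - u) (p' - p) v = formA α η γ ς₂ u' p' v - formA α η γ ς₂ u p v := by
  simp only [formA, setIntegral_cell_const, traction_sub, avgQ_sub, sub_smul,
    integral_inner_left_sub, stress_sub, Matrix.sub_apply, sub_mul, mul_sub, Pi.sub_apply,
    Finset.sum_sub_distrib,
    integral_inner_jumpV_sub _ _ _ (continuous_const (y := traction η γ v _)),
    integral_inner_jumpV_sub _ _ _ (continuous_jumpV v _)]
  ring

/-- The pairing of a piecewise constant function with the discrete divergence,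
`∑_K (q, ∇·v)_K - ∑_e ⟨{q n_e}, [v]⟩_e`. -/
noncomputable def divPairing (q : M.Q) (v : M.V) : ℝ :=
  (∑ K : M.Cell, M.vol K * (q K * dvg v K))
    - ∑ e : M.IFace, ∫ x in M.faceSet e, inner ℝ (avgQ q e • M.normal e) (jumpV v e x) ∂μHE[d - 1]

theorem divPairing_smul (q : M.Q) (r : ℝ) (v : M.V) :
    divPairing q (r • v) = r * divPairing q v := by
  simp only [divPairing, dvg_smul, jumpV_smul, inner_smul_right, integral_const_mul, mul_sub,
    Finset.mul_sum]
  congr 1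
  exact Finset.sum_congr rfl fun K _ => by ring

/-- The `L¹` size of the divergences and jumps of a piecewise affine vector field. -/
noncomputable def brokenL1 (v : M.V) : ℝ :=
  (∑ K : M.Cell, M.vol K * |dvg v K|)
    + ∑ e : M.IFace, ∫ x in M.faceSet e, ‖jumpV v e x‖ ∂μHE[d - 1]

theorem abs_divPairing_le {q : M.Q} {P : ℝ} (hq : ∀ K, |q K| ≤ P) (v : M.V) :
    |divPairing q v| ≤ P * brokenL1 v := by
  have hP : 0 ≤ P := (abs_nonneg _).trans (hq (Classical.arbitrary _))
  have h1 : |∑ K : M.Cell, M.vol K * (q K * dvg v K)| ≤ ∑ K : M.Cell, P * (M.vol K * |dvg v K|) := by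
    refine (Finset.abs_sum_le_sum_abs _ _).trans (Finset.sum_le_sum fun K _ => ?_)
    rw [abs_mul, abs_mul, abs_of_pos (vol_pos K)]
    have := mul_le_mul_of_nonneg_left (hq K)
      (mul_nonneg (vol_pos K).le (abs_nonneg (dvg v K)))
    linarith
  have h2 : |∑ e : M.IFace, ∫ x in M.faceSet e,
      inner ℝ (avgQ q e • M.normal e) (jumpV v e x) ∂μHE[d - 1]|
      ≤ ∑ e : M.IFace, P * ∫ x in M.faceSet e, ‖jumpV v e x‖ ∂μHE[d - 1] := by
    refine (Finset.abs_sum_le_sum_abs _ _).trans (Finset.sum_le_sum fun e _ => ?_)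
    have hc := continuous_jumpV v e
    rw [← integral_const_mul, ← Real.norm_eq_abs]
    refine norm_integral_le_of_norm_le (integrable_faceSet e (by fun_prop))
      (Filter.Eventually.of_forall fun x => ?_)
    refine (norm_inner_le_norm _ _).trans ?_
    refine mul_le_mul_of_nonneg_right ?_ (norm_nonneg _)
    rw [norm_smul, Real.norm_eq_abs]
    have := mul_le_mul (abs_avgQ_le hq e) (norm_normal_le e) (norm_nonneg _) hP
    linarith
  rw [brokenL1, mul_add, Finset.mul_sum, Finset.mul_sum, divPairing]
  exact (abs_sub _ _).trans (add_le_add h1 h2)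

/-! ### Coercivity of the interior penalty form -/

theorem trace_strain (v : M.V) (K : M.Cell) : (strain v K).trace = dvg v K := by
  simp only [strain, Matrix.trace_smul, Matrix.trace_add, Matrix.trace_transpose, dvg, smul_eq_mul]
  ring

/-- The elastic energy density of `v` on a cell. -/
noncomputable def energyDensity (η γ : ℝ) (v : M.V) (K : M.Cell) : ℝ :=
  2 * η * (∑ i, ∑ j, strain v K i j ^ 2) + γ * dvg v K ^ 2

theorem sum_stress_mul_strain (η γ : ℝ) (v : M.V) (K : M.Cell) :
    ∑ i, ∑ j, stress η γ v K i j * strain v K i j = energyDensity η γ v K := by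
  have h : ∀ i, ∑ j, stress η γ v K i j * strain v K i j
      = 2 * η * (∑ j, strain v K i j ^ 2) + γ * dvg v K * strain v K i i := by
    intro i
    simp only [stress, Matrix.add_apply, Matrix.smul_apply, smul_eq_mul, add_mul,
      Finset.sum_add_distrib, Finset.mul_sum]
    congr 1
    · exact Finset.sum_congr rfl fun j _ => by ring
    · simp [Matrix.one_apply]
  simp only [h, Finset.sum_add_distrib, ← Finset.mul_sum]
  have := trace_strain v K
  simp only [Matrix.trace, Matrix.diag_apply] at this
  rw [this, energyDensity]; ring

theorem norm_sq_mulVec_le (A : Matrix (Fin d) (Fin d) ℝ) (n : EuclideanSpace ℝ (Fin d)) :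
    ‖(WithLp.toLp 2 (A.mulVec n.ofLp) : EuclideanSpace ℝ (Fin d))‖ ^ 2
      ≤ (∑ i, ∑ j, A i j ^ 2) * ‖n‖ ^ 2 := by
  simp only [EuclideanSpace.real_norm_sq_eq, Finset.sum_mul]
  refine Finset.sum_le_sum fun i _ => ?_
  rw [← Finset.sum_mul]
  exact Finset.sum_mul_sq_le_sq_mul_sq Finset.univ (fun j => A i j) n.ofLp

theorem norm_sq_add_le {E : Type*} [NormedAddCommGroup E] (x y : E) :
    ‖x + y‖ ^ 2 ≤ 2 * (‖x‖ ^ 2 + ‖y‖ ^ 2) := by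
  have h := norm_add_le x y
  have h0 := norm_nonneg (x + y)
  nlinarith [sq_nonneg (‖x‖ - ‖y‖)]

/-- The assumption 2η ≤ γ trades (2η)² for 2ηγ, so that both parts of the stress are controlled by a
single factor γ times the energy. -/
theorem norm_sq_stress_mulVec_le {η γ : ℝ} (hη : 0 < η) (hγ : 2 * η ≤ γ) (v : M.V) (K : M.Cell)
    {n : EuclideanSpace ℝ (Fin d)} (hn : ‖n‖ ≤ 1) :
    ‖(WithLp.toLp 2 ((stress η γ v K).mulVec n.ofLp) : EuclideanSpace ℝ (Fin d))‖ ^ 2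
      ≤ 2 * γ * energyDensity η γ v K := by
  have hsplit : (WithLp.toLp 2 ((stress η γ v K).mulVec n.ofLp) : EuclideanSpace ℝ (Fin d))
      = (2 * η) • WithLp.toLp 2 ((strain v K).mulVec n.ofLp) + (γ * dvg v K) • n := by
    simp [stress, Matrix.add_mulVec, Matrix.smul_mulVec]
  have hn2 : ‖n‖ ^ 2 ≤ 1 := by have := norm_nonneg n; nlinarith
  have hS : 0 ≤ ∑ i, ∑ j, strain v K i j ^ 2 := by positivity
  set S := ∑ i, ∑ j, strain v K i j ^ 2 with hSdef
  have h1 : ‖(WithLp.toLp 2 ((strain v K).mulVec n.ofLp) : EuclideanSpace ℝ (Fin d))‖ ^ 2 ≤ S :=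
    (norm_sq_mulVec_le _ _).trans (mul_le_of_le_one_right hS hn2)
  rw [hsplit]
  refine (norm_sq_add_le _ _).trans ?_
  rw [norm_smul, norm_smul, mul_pow, mul_pow, Real.norm_eq_abs, Real.norm_eq_abs, sq_abs, sq_abs,
    energyDensity, ← hSdef]
  have h2 : (2 * η) ^ 2 * ‖(WithLp.toLp 2 ((strain v K).mulVec n.ofLp) :
      EuclideanSpace ℝ (Fin d))‖ ^ 2 ≤ γ * (2 * η) * S := by
    calc _ ≤ (2 * η) ^ 2 * S := mul_le_mul_of_nonneg_left h1 (sq_nonneg _)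
      _ ≤ γ * (2 * η) * S := by
        refine mul_le_mul_of_nonneg_right ?_ hS
        nlinarith
  have h3 : (γ * dvg v K) ^ 2 * ‖n‖ ^ 2 ≤ (γ * dvg v K) ^ 2 :=
    mul_le_of_le_one_right (sq_nonneg _) hn2
  nlinarith

theorem norm_sq_traction_le {η γ : ℝ} (hη : 0 < η) (hγ : 2 * η ≤ γ) (v : M.V) (e : M.IFace) :
    ‖traction η γ v e‖ ^ 2
      ≤ γ * (energyDensity η γ v (M.fst e) + energyDensity η γ v (M.snd e)) := by
  rw [traction, norm_smul, mul_pow]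
  have h := norm_sq_add_le
    (WithLp.toLp 2 ((stress η γ v (M.fst e)).mulVec (M.normal e).ofLp) :
      EuclideanSpace ℝ (Fin d))
    (WithLp.toLp 2 ((stress η γ v (M.snd e)).mulVec (M.normal e).ofLp))
  have h1 := norm_sq_stress_mulVec_le hη hγ v (M.fst e) (norm_normal_le e)
  have h2 := norm_sq_stress_mulVec_le hη hγ v (M.snd e) (norm_normal_le e)
  norm_num
  linarith

/-- Squared `L²` norm of the jump on an interior face. -/
noncomputable def jumpSq (v : M.V) (e : M.IFace) : ℝ :=
  ∫ x in M.faceSet e, ‖jumpV v e x‖ ^ 2 ∂μHE[d - 1]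

theorem jumpSq_nonneg (v : M.V) (e : M.IFace) : 0 ≤ jumpSq v e :=
  integral_nonneg fun _ => sq_nonneg _

/-- Makes positivity of face areas unnecessary: where ς₂/|e| is a division by zero, the jump it
should control vanishes as well. -/
theorem jumpSq_eq_zero_of_area_eq_zero (v : M.V) {e : M.IFace} (he : M.area e = 0) :
    jumpSq v e = 0 := by
  have h : μHE[d - 1] (M.faceSet e) = 0 := by
    rcases (ENNReal.toReal_eq_zero_iff _).1 he with h | h
    · exact h
    · exact absurd h (faceSet_measure_lt_top e).ne
  rw [jumpSq, Measure.restrict_eq_zero.2 h, integral_zero_measure]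

/-- Young's inequality with weight r, integrated over the face; t is constant there because
tractions of affine fields are. -/
theorem two_mul_integral_inner_jumpV_le (v : M.V) (e : M.IFace) (t : EuclideanSpace ℝ (Fin d))
    {r : ℝ} (hr : 0 < r) :
    2 * ∫ x in M.faceSet e, inner ℝ t (jumpV v e x) ∂μHE[d - 1]
      ≤ M.area e * (r * ‖t‖ ^ 2) + r⁻¹ * jumpSq v e := by
  have hc := continuous_jumpV v e
  rw [← setIntegral_face_const, jumpSq, ← integral_const_mul, ← integral_const_mul,
    ← integral_add (integrable_faceSet e (by fun_prop)) (integrable_faceSet e (by fun_prop))]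
  refine integral_mono (integrable_faceSet e (by fun_prop)) (integrable_faceSet e (by fun_prop))
    fun x => ?_
  have h1 := real_inner_le_norm t (jumpV v e x)
  have h2 : 0 ≤ r⁻¹ * (r * ‖t‖ - ‖jumpV v e x‖) ^ 2 := by positivity
  have h3 : r⁻¹ * (r * ‖t‖ - ‖jumpV v e x‖) ^ 2
      = r * ‖t‖ ^ 2 + r⁻¹ * ‖jumpV v e x‖ ^ 2 - 2 * (‖t‖ * ‖jumpV v e x‖) := by
    field_simp; ring
  simp only
  linarith

theorem formA_self (α η γ ς₂ : ℝ) (v : M.V) (p : M.Q) :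
    formA α η γ ς₂ v p v = (∑ K : M.Cell, M.vol K * energyDensity η γ v K)
      - (∑ e : M.IFace,
          2 * ∫ x in M.faceSet e, inner ℝ (traction η γ v e) (jumpV v e x) ∂μHE[d - 1])
      + (∑ e : M.IFace, ς₂ / M.area e * jumpSq v e) - α * divPairing p v := by
  simp only [formA, setIntegral_cell_const, sum_stress_mul_strain, divPairing, jumpSq,
    real_inner_self_eq_norm_sq, fun (e : M.IFace) (x : EuclideanSpace ℝ (Fin d)) =>
      real_inner_comm (traction η γ v e) (jumpV v e x), ← Finset.mul_sum]
  ring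

/-- Squared `L²` size of the divergences and jumps of a piecewise affine vector field. -/
noncomputable def brokenSq (v : M.V) : ℝ :=
  (1 / 2) * (∑ K : M.Cell, M.vol K * dvg v K ^ 2) + ∑ e : M.IFace, jumpSq v e

variable (M) in
/-- Total measure of the cells and interior faces. -/
noncomputable def totalMeasure : ℝ := (∑ K : M.Cell, M.vol K) + ∑ e : M.IFace, M.area e

theorem totalMeasure_nonneg : 0 ≤ M.totalMeasure :=
  add_nonneg (Finset.sum_nonneg fun K _ => (vol_pos K).le)
    (Finset.sum_nonneg fun e _ => area_nonneg e)

theorem energyDensity_nonneg {η γ : ℝ} (hη : 0 < η) (hγ : 2 * η ≤ γ) (v : M.V) (K : M.Cell) :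
    0 ≤ energyDensity η γ v K := by
  have hγ0 : 0 < γ := by linarith
  unfold energyDensity
  positivity

/-- Stands in for the discrete trace inequality: strains are constant on cells, so a face value of
the energy density is a cell value. The constant is crude but depends on the mesh only. -/
theorem energyDensity_le_sum {η γ : ℝ} (hη : 0 < η) (hγ : 2 * η ≤ γ) (v : M.V) (K : M.Cell) :
    energyDensity η γ v K
      ≤ (∑ L : M.Cell, (M.vol L)⁻¹) * ∑ L : M.Cell, M.vol L * energyDensity η γ v L := by
  have h0 : ∀ L : M.Cell, 0 ≤ M.vol L * energyDensity η γ v L := fun L =>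
    mul_nonneg (vol_pos L).le (energyDensity_nonneg hη hγ v L)
  have h1 : (M.vol K)⁻¹ ≤ ∑ L : M.Cell, (M.vol L)⁻¹ :=
    Finset.single_le_sum (f := fun L : M.Cell => (M.vol L)⁻¹)
      (fun L _ => (inv_pos.2 (vol_pos L)).le) (Finset.mem_univ K)
  have h2 : M.vol K * energyDensity η γ v K ≤ ∑ L : M.Cell, M.vol L * energyDensity η γ v L :=
    Finset.single_le_sum (f := fun L : M.Cell => M.vol L * energyDensity η γ v L)
      (fun L _ => h0 L) (Finset.mem_univ K)
  calc energyDensity η γ v K = (M.vol K)⁻¹ * (M.vol K * energyDensity η γ v K) := by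
        rw [inv_mul_cancel_left₀ (vol_pos K).ne']
    _ ≤ _ := mul_le_mul h1 h2 (h0 K) ((inv_pos.2 (vol_pos K)).le.trans h1)

theorem consistency_le {η γ m : ℝ} (hη : 0 < η) (hγ : 2 * η ≤ γ) (hm : 0 < m) (v : M.V) :
    (∑ e : M.IFace,
      2 * ∫ x in M.faceSet e, inner ℝ (traction η γ v e) (jumpV v e x) ∂μHE[d - 1])
      ≤ (∑ e : M.IFace, M.area e) * (2 * ((∑ K : M.Cell, (M.vol K)⁻¹) *
          ∑ K : M.Cell, M.vol K * energyDensity η γ v K) / m)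
        + γ * m * ∑ e : M.IFace, jumpSq v e := by
  have hγ0 : 0 < γ := by linarith
  rw [Finset.sum_mul, Finset.mul_sum _ _ (γ * m), ← Finset.sum_add_distrib]
  refine Finset.sum_le_sum fun e _ => ?_
  have h := two_mul_integral_inner_jumpV_le v e (traction η γ v e)
    (r := (γ * m)⁻¹) (by positivity)
  rw [inv_inv] at h
  refine h.trans (add_le_add ?_ le_rfl)
  refine mul_le_mul_of_nonneg_left ?_ (area_nonneg e)
  have h1 := energyDensity_le_sum hη hγ v (M.fst e)
  have h2 := energyDensity_le_sum hη hγ v (M.snd e)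
  have h3 := norm_sq_traction_le hη hγ v e
  generalize (∑ K : M.Cell, (M.vol K)⁻¹) *
    ∑ K : M.Cell, M.vol K * energyDensity η γ v K = X at h1 h2 ⊢
  calc (γ * m)⁻¹ * ‖traction η γ v e‖ ^ 2 ≤ (γ * m)⁻¹ * (γ * (2 * X)) := by
        refine mul_le_mul_of_nonneg_left (h3.trans ?_) (by positivity)
        exact mul_le_mul_of_nonneg_left (by linarith) hγ0.le
    _ = 2 * X / m := by field_simp

variable (M) in
/-- Coercivity of the interior penalty form for a sufficiently large penalty parameter. -/
theorem exists_penalty_coercive : ∃ κ > 0, ∀ α η γ ς₂ : ℝ, 0 < η → 2 * η ≤ γ → κ * γ ≤ ς₂ →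
    ∀ (v : M.V) (p : M.Q), γ * brokenSq v ≤ formA α η γ ς₂ v p v + α * divPairing p v := by
  obtain ⟨A, hA⟩ : ∃ A, A = ∑ e : M.IFace, M.area e := ⟨_, rfl⟩
  obtain ⟨I, hI⟩ : ∃ I, I = ∑ K : M.Cell, (M.vol K)⁻¹ := ⟨_, rfl⟩
  have hA0 : 0 ≤ A := hA ▸ Finset.sum_nonneg fun e _ => area_nonneg e
  have hI0 : 0 ≤ I := hI ▸ Finset.sum_nonneg fun K _ => (inv_pos.2 (vol_pos K)).le
  -- With m ≥ 4AI the consistency terms consume at most half of the elastic energy S; the summand 1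
  -- keeps m positive.
  obtain ⟨m, hm⟩ : ∃ m, m = 4 * A * I + 1 := ⟨_, rfl⟩
  have hm0 : 0 < m := by rw [hm]; positivity
  -- As |e| ≤ A, this κ yields ς₂/|e| ≥ γ(m + 1) whenever |e| > 0: γm pays for Young's inequality
  -- and γ is left over for the jumps.
  refine ⟨(A + 1) * (m + 1), by positivity, fun α η γ ς₂ hη hγ hς v p => ?_⟩
  have hγ0 : 0 < γ := by linarith
  obtain ⟨S, hS⟩ : ∃ S, S = ∑ K : M.Cell, M.vol K * energyDensity η γ v K := ⟨_, rfl⟩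
  have hS0 : 0 ≤ S := hS ▸ Finset.sum_nonneg fun K _ =>
    mul_nonneg (vol_pos K).le (energyDensity_nonneg hη hγ v K)
  have hcons := consistency_le hη hγ hm0 v
  rw [← hA, ← hI, ← hS] at hcons
  have hhalf : A * (2 * (I * S) / m) ≤ 1 / 2 * S := by
    rw [mul_div_assoc', div_le_iff₀ hm0, hm]
    linarith
  have hpen : ∑ e : M.IFace, (γ * m + γ) * jumpSq v e
      ≤ ∑ e : M.IFace, ς₂ / M.area e * jumpSq v e := by
    refine Finset.sum_le_sum fun e _ => ?_
    rcases (area_nonneg e).eq_or_lt with he | he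
    · simp [jumpSq_eq_zero_of_area_eq_zero v he.symm]
    · refine mul_le_mul_of_nonneg_right ?_ (jumpSq_nonneg v e)
      rw [le_div_iff₀ he]
      have hle : M.area e ≤ A := hA ▸ Finset.single_le_sum (f := fun e : M.IFace => M.area e)
        (fun e _ => area_nonneg e) (Finset.mem_univ e)
      calc (γ * m + γ) * M.area e ≤ (γ * m + γ) * (A + 1) :=
            mul_le_mul_of_nonneg_left (by linarith) (by positivity)
        _ = (A + 1) * (m + 1) * γ := by ring
        _ ≤ ς₂ := hς
  have hdiv : γ * ∑ K : M.Cell, M.vol K * dvg v K ^ 2 ≤ S := by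
    rw [hS, Finset.mul_sum]
    refine Finset.sum_le_sum fun K _ => ?_
    have : γ * dvg v K ^ 2 ≤ energyDensity η γ v K := by
      have : 0 ≤ 2 * η * ∑ i, ∑ j, strain v K i j ^ 2 := by positivity
      rw [energyDensity]; linarith
    linarith [mul_le_mul_of_nonneg_left this (vol_pos K).le]
  rw [formA_self, brokenSq]
  rw [← Finset.mul_sum] at hpen
  rw [← hS]
  linarith

/-! ### Size of the displacement -/

theorem brokenL1_le (v : M.V) {t : ℝ} (ht : 0 < t) :
    brokenL1 v ≤ 2 * t * brokenSq v + t⁻¹ * M.totalMeasure := by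
  have young : ∀ x : ℝ, x ≤ t * x ^ 2 + t⁻¹ := fun x => by
    have h : 0 ≤ t⁻¹ * ((t * x - 1 / 2) ^ 2 + 3 / 4) := by positivity
    have h' : t⁻¹ * ((t * x - 1 / 2) ^ 2 + 3 / 4) = t * x ^ 2 + t⁻¹ - x := by field_simp; ring
    linarith
  have h1 : ∑ K : M.Cell, M.vol K * |dvg v K|
      ≤ ∑ K : M.Cell, (t * (M.vol K * dvg v K ^ 2) + t⁻¹ * M.vol K) := by
    refine Finset.sum_le_sum fun K _ => ?_
    have h := mul_le_mul_of_nonneg_left (young |dvg v K|) (vol_pos K).le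
    rw [sq_abs] at h
    linarith
  have h2 : ∑ e : M.IFace, ∫ x in M.faceSet e, ‖jumpV v e x‖ ∂μHE[d - 1]
      ≤ ∑ e : M.IFace, (t * jumpSq v e + t⁻¹ * M.area e) := by
    refine Finset.sum_le_sum fun e _ => ?_
    have hc := continuous_jumpV v e
    rw [mul_comm t⁻¹, ← setIntegral_face_const, jumpSq, ← integral_const_mul,
      ← integral_add (integrable_faceSet e (by fun_prop)) (integrable_faceSet e (by fun_prop))]
    exact integral_mono (integrable_faceSet e (by fun_prop)) (integrable_faceSet e (by fun_prop))
      fun x => young _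
  have h3 : 0 ≤ t * ∑ e : M.IFace, jumpSq v e :=
    mul_nonneg ht.le (Finset.sum_nonneg fun e _ => jumpSq_nonneg v e)
  simp only [Finset.sum_add_distrib, ← Finset.mul_sum] at h1 h2
  rw [brokenL1, brokenSq, totalMeasure]
  linarith

/-- The displacement driven by a bounded pressure is of size `O(1/γ)`. -/
theorem brokenL1_le_of_momentum {α γ P : ℝ} (hα : 0 < α) (hγ : 0 < γ) (hP : 0 < P)
    {v : M.V} {p : M.Q} (hp : ∀ K, |p K| ≤ P) (hv : γ * brokenSq v ≤ α * divPairing p v) :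
    brokenL1 v ≤ 8 * α * P * M.totalMeasure / γ := by
  have h1 : γ * brokenSq v ≤ α * (P * brokenL1 v) :=
    hv.trans (mul_le_mul_of_nonneg_left ((le_abs_self _).trans (abs_divPairing_le hp v)) hα.le)
  -- With this weight the quadratic term is at most half of `brokenL1 v` and is absorbed on the
  -- left.
  have h2 := brokenL1_le v (t := γ / (4 * α * P)) (by positivity)
  have h3 : 2 * (γ / (4 * α * P)) * brokenSq v ≤ brokenL1 v / 2 := by
    calc 2 * (γ / (4 * α * P)) * brokenSq v = (γ * brokenSq v) / (2 * α * P) := by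
          field_simp; ring
      _ ≤ (α * (P * brokenL1 v)) / (2 * α * P) := by gcongr
      _ = brokenL1 v / 2 := by field_simp
  have h4 : (γ / (4 * α * P))⁻¹ * M.totalMeasure = 4 * α * P * M.totalMeasure / γ := by
    rw [inv_div]; ring
  rw [h4] at h2
  have h5 : 8 * α * P * M.totalMeasure / γ = 2 * (4 * α * P * M.totalMeasure / γ) := by ring
  linarith

end Mesh

/-! ### Bounds for the Peng-Robinson pressure -/

namespace Fluid

variable (F : Fluid)

theorem contDiffOn_helmholtz : ContDiffOn ℝ 1 F.helmholtz (Set.Ioo 0 (1 / F.β)) := by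
  have hβ := F.β_pos
  have hs : (1:ℝ) < Real.sqrt 2 := by
    rw [Real.lt_sqrt] <;> norm_num
  -- Keeps the numerator in the attraction logarithm positive for βc < 1.
  have hs2 : Real.sqrt 2 < 2 := by
    rw [Real.sqrt_lt] <;> norm_num
  intro c hc
  have hc0 := hc.1
  have hy0 : 0 < F.β * c := mul_pos hβ hc0
  have hy1 : F.β * c < 1 := by
    have := (lt_div_iff₀ hβ).1 hc.2; linarith
  have hnum : 0 < 1 + (1 - Real.sqrt 2) * F.β * c := by nlinarith
  have hden : 0 < 1 + (1 + Real.sqrt 2) * F.β * c := by nlinarith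
  have hrep : 1 - F.β * c ≠ 0 := by linarith
  have hquot : (1 + (1 - Real.sqrt 2) * F.β * c) / (1 + (1 + Real.sqrt 2) * F.β * c) ≠ 0 :=
    (div_pos hnum hden).ne'
  refine ContDiffAt.contDiffWithinAt ?_
  unfold helmholtz
  refine ContDiffAt.add (ContDiffAt.add ?_ ?_) ?_
  · exact ContDiffAt.mul (by fun_prop) (ContDiffAt.log contDiffAt_id hc0.ne')
  · have h : ContDiffAt ℝ 1 (fun c => 1 - F.β * c) c := by fun_prop
    exact (ContDiffAt.mul (by fun_prop) (h.log hrep)).neg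
  · exact ContDiffAt.mul (by fun_prop)
      (ContDiffAt.log (ContDiffAt.div (by fun_prop) (by fun_prop) hden.ne') hquot)

theorem continuousOn_pressure : ContinuousOn F.pressure (Set.Ioo 0 (1 / F.β)) := by
  have h := F.contDiffOn_helmholtz
  have hd : ContinuousOn F.chemPot (Set.Ioo 0 (1 / F.β)) :=
    h.continuousOn_deriv_of_isOpen isOpen_Ioo le_rfl
  exact (continuousOn_id.mul hd).sub h.continuousOn

theorem exists_pressure_bound {ϱ₀ ϱ : ℝ} (hϱ₀ : 0 < ϱ₀) (hϱ : ϱ < 1) :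
    ∃ B > 0, ∀ c, ϱ₀ ≤ F.β * c → F.β * c ≤ ϱ → |F.pressure c| ≤ B := by
  have hβ := F.β_pos
  have hsub : Set.Icc (ϱ₀ / F.β) (ϱ / F.β) ⊆ Set.Ioo 0 (1 / F.β) := fun c hc =>
    ⟨(div_pos hϱ₀ hβ).trans_le hc.1, hc.2.trans_lt (div_lt_div_of_pos_right hϱ hβ)⟩
  obtain ⟨C, hC⟩ := isCompact_Icc.exists_bound_of_continuousOn (F.continuousOn_pressure.mono hsub)
  refine ⟨max C 1, by positivity, fun c h1 h2 => ?_⟩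
  have := hC c ⟨(div_le_iff₀ hβ).2 (by linarith), (le_div_iff₀ hβ).2 (by linarith)⟩
  exact this.trans (le_max_left _ _)

/-- The factor c cancels the one in ζ, so the stabilized pressure is affine in c' and stays bounded
even where c' leaves the range [ϱ₀/β, ϱ/β]. -/
theorem stabPressure_eq {θ c : ℝ} (hc : c ≠ 0) (c' : ℝ) :
    F.stabPressure θ c c' = F.pressure c + θ * F.R * F.T * ((c' - c) / (1 - F.β * c) ^ 2) := by
  have : c * F.zeta c c' = (c' - c) / (1 - F.β * c) ^ 2 := by
    unfold zeta; rw [mul_div_assoc', mul_div_mul_left _ _ hc]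
  rw [← this]
  unfold stabPressure stabPot pressure
  ring

theorem abs_stabPressure_le {B θ Θ Z c c' : ℝ} (hc : c ≠ 0) (hB : |F.pressure c| ≤ B)
    (hθ0 : 0 ≤ θ) (hθ : θ ≤ Θ) (hZ : |(c' - c) / (1 - F.β * c) ^ 2| ≤ Z) :
    |F.stabPressure θ c c'| ≤ B + Θ * F.R * F.T * Z := by
  have hR := F.R_pos
  have hT := F.T_pos
  rw [stabPressure_eq F hc]
  refine (abs_add_le _ _).trans (add_le_add hB ?_)
  rw [abs_mul, abs_of_nonneg (by positivity)]
  gcongr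
  have := hθ0.trans hθ
  positivity

end Fluid

namespace Mesh

variable {d : ℕ} {M : Mesh d}

/-! ### Bounds for the stabilization parameter -/

theorem one_le_theta (F : Fluid) (δ₁ δ₂ : ℝ) (c : M.Q) : 1 ≤ theta F δ₁ δ₂ c :=
  le_ciSup_of_le (Set.finite_range _).bddAbove (Classical.arbitrary _) (le_max_left _ _)

/-- With y = βc, one has χ₁ ≥ 1 - δ₁ and 1 - χ₁y ≥ 1 - y, so the first quotient is at most 1/(1 -
δ₁). Further 1 - χ₂y = (1 - y)(1 - δ₂y(1 - y)) ≥ ¾(1 - y), so the second is at most 16/9. The bound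
involves neither the mesh nor the density, which lets N₀ be chosen before the mesh. -/
theorem theta_le {F : Fluid} {δ₁ δ₂ : ℝ} (hδ₁ : 0 < δ₁ ∧ δ₁ < 1) (hδ₂ : 0 < δ₂ ∧ δ₂ < 1)
    {c : M.Q} (hc : ∀ K, 0 < F.β * c K ∧ F.β * c K < 1) :
    theta F δ₁ δ₂ c ≤ 2 / (1 - δ₁) := by
  have hd : 0 < 1 - δ₁ := by linarith
  refine ciSup_le fun K => ?_
  obtain ⟨h0, h1⟩ := hc K
  simp only
  set y := F.β * c K
  have hz : 0 < 1 - y := by linarith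
  have hz1 : (1 - y) ^ 2 ≤ 1 := by nlinarith
  have hsq : 0 < (1 - y) ^ 2 := by positivity
  have h2 : 2 ≤ 2 / (1 - δ₁) := by rw [le_div_iff₀ hd]; linarith
  refine max_le (by linarith) (max_le ?_ ?_)
  · have hχ : 1 - δ₁ ≤ 1 - δ₁ * (1 - y) ^ 2 := by nlinarith
    have hχ0 : 0 ≤ 1 - δ₁ * (1 - y) ^ 2 := hd.le.trans hχ
    have hq : 1 - y ≤ 1 - (1 - δ₁ * (1 - y) ^ 2) * y := by
      have : 0 ≤ δ₁ * (1 - y) ^ 2 * y := by have := hδ₁.1; positivity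
      linarith
    have hq2 : (1 - y) ^ 2 ≤ (1 - (1 - δ₁ * (1 - y) ^ 2) * y) ^ 2 := by gcongr
    calc _ ≤ (1 - y) ^ 2 / ((1 - δ₁) * (1 - y) ^ 2) := by gcongr
      _ = 1 / (1 - δ₁) := by field_simp
      _ ≤ 2 / (1 - δ₁) := by gcongr; norm_num
  · have hχ : 1 ≤ 1 + δ₂ * (1 - y) ^ 2 := by have := hδ₂.1; nlinarith
    have hy : δ₂ * (y * (1 - y)) ≤ 1 / 4 := by
      have h4 : y * (1 - y) ≤ 1 / 4 := by nlinarith [sq_nonneg (y - 1 / 2)]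
      have := mul_nonneg h0.le hz.le
      nlinarith [hδ₂.1, hδ₂.2]
    have hq : 3 / 4 * (1 - y) ≤ 1 - (1 + δ₂ * (1 - y) ^ 2) * y := by nlinarith
    have hq2 : (3 / 4 * (1 - y)) ^ 2 ≤ (1 - (1 + δ₂ * (1 - y) ^ 2) * y) ^ 2 := by gcongr
    calc _ ≤ (1 - y) ^ 2 / (1 * (3 / 4 * (1 - y)) ^ 2) := by gcongr
      _ = 16 / 9 := by field_simp; norm_num
      _ ≤ 2 / (1 - δ₁) := by linarith

/-! ### Adaptive time step, mass balance and maximum principle -/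

theorem sum_mul_le_sum_filter_pos {ι : Type*} [Fintype ι] (w x : ι → ℝ) (hw : ∀ i, 0 ≤ w i)
    [DecidablePred fun i => 0 < x i] : ∑ i, w i * x i ≤ ∑ i with 0 < x i, w i * x i := by
  rw [Finset.sum_filter]
  refine Finset.sum_le_sum fun i _ => ?_
  split_ifs with h
  · exact le_rfl
  · exact mul_nonpos_of_nonneg_of_nonpos (hw i) (not_lt.1 h)

theorem sum_filter_neg_le_sum_mul {ι : Type*} [Fintype ι] (w x : ι → ℝ) (hw : ∀ i, 0 ≤ w i)
    [DecidablePred fun i => x i < 0] : ∑ i with x i < 0, w i * x i ≤ ∑ i, w i * x i := by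
  rw [Finset.sum_filter]
  refine Finset.sum_le_sum fun i _ => ?_
  split_ifs with h
  · exact le_rfl
  · exact mul_nonneg (hw i) (not_lt.1 h)

theorem upwind_pos {w : M.RT} {c : M.Q} (hc : ∀ K, 0 < c K) (e : M.IFace) : 0 < upwind w c e := by
  unfold upwind
  split_ifs
  exacts [hc _, hc _]

/-- Outflow of mass from a cell for the velocity `uf` and the chemical potential `μ(c)`. -/
noncomputable def outflow (D : Data M) (s : State M) (uf : M.RT) (K : M.Cell) : ℝ :=
  (∑ e : M.IFace, upwind s.uf s.c e * (sgn K e * flux uf e))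
    + ∑ e : M.IFace, D.ς₁ / M.area e * M.area e *
        (sgn K e * jumpQ (fun L => D.F.chemPot (s.c L)) e)

/-- The adaptive time step is positive and limits the in- and outflow of each cell. -/
theorem timeStep_spec {D : Data M} {s : State M} {φ : M.Q} (uf : M.RT) (hς : 0 < D.ς₁)
    (hε : 0 < D.ε) (hτ : 0 < D.τmax) (hc : ∀ K, 0 < s.c K)
    (hlow : ∀ K, s.φ K < φ K * (1 + (1 - D.F.β * s.c K) ^ 2 * D.δ₂))
    (hup : ∀ K, φ K * (1 - (1 - D.F.β * s.c K) ^ 2 * D.δ₁) < s.φ K) :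
    0 < timeStep D s φ uf ∧ ∀ K,
      timeStep D s φ uf * outflow D s uf K
        ≤ (φ K * s.c K * (1 - D.F.β * s.c K) ^ 2 * D.δ₁ - (φ K - s.φ K) * s.c K) * M.vol K ∧
      -(timeStep D s φ uf * outflow D s uf K)
        ≤ (φ K * s.c K * (1 - D.F.β * s.c K) ^ 2 * D.δ₂ + (φ K - s.φ K) * s.c K) * M.vol K := by
  classical
  have hup0 : ∀ e : M.IFace, 0 ≤ upwind s.uf s.c e := fun e => (upwind_pos hc e).le
  have hpen0 : ∀ e : M.IFace, 0 ≤ D.ς₁ / M.area e * M.area e := fun e =>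
    mul_nonneg (div_nonneg hς.le (area_nonneg e)) (area_nonneg e)
  let X : M.Cell → M.IFace → ℝ := fun K e => sgn K e * flux uf e
  let Y : M.Cell → M.IFace → ℝ := fun K e => sgn K e * jumpQ (fun L => D.F.chemPot (s.c L)) e
  let out : M.Cell → ℝ := fun K => (∑ e with 0 < X K e, upwind s.uf s.c e * X K e)
    + ∑ e with 0 < Y K e, D.ς₁ / M.area e * M.area e * Y K e
  let inn : M.Cell → ℝ := fun K => (∑ e with X K e < 0, upwind s.uf s.c e * X K e)
    + ∑ e with Y K e < 0, D.ς₁ / M.area e * M.area e * Y K e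
  let n₁ : M.Cell → ℝ := fun K =>
    (φ K * s.c K * (1 - D.F.β * s.c K) ^ 2 * D.δ₁ - (φ K - s.φ K) * s.c K) * M.vol K
  let n₂ : M.Cell → ℝ := fun K =>
    (φ K * s.c K * (1 - D.F.β * s.c K) ^ 2 * D.δ₂ + (φ K - s.φ K) * s.c K) * M.vol K
  have hts : timeStep D s φ uf
      = ⨅ K : M.Cell, min (n₁ K / (out K + D.ε)) (min (n₂ K / (-inn K + D.ε)) D.τmax) := by
    -- The weight ς₁/|e| · |e| is left uncancelled; only its nonnegativity matters, so |e| ≠ 0 is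
    -- not required.
    simp only [timeStep, n₁, n₂, out, inn, X, Y, mul_right_comm _ _ (M.area _)]
  have hout0 : ∀ K, 0 ≤ out K := fun K => add_nonneg
    (Finset.sum_nonneg fun e he => mul_nonneg (hup0 e) (Finset.mem_filter.1 he).2.le)
    (Finset.sum_nonneg fun e he => mul_nonneg (hpen0 e) (Finset.mem_filter.1 he).2.le)
  have hinn0 : ∀ K, inn K ≤ 0 := fun K => add_nonpos
    (Finset.sum_nonpos fun e he =>
      mul_nonpos_of_nonneg_of_nonpos (hup0 e) (Finset.mem_filter.1 he).2.le)
    (Finset.sum_nonpos fun e he =>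
      mul_nonpos_of_nonneg_of_nonpos (hpen0 e) (Finset.mem_filter.1 he).2.le)
  have hout : ∀ K, outflow D s uf K ≤ out K := fun K => add_le_add
    (sum_mul_le_sum_filter_pos (upwind s.uf s.c) (X K) hup0)
    (sum_mul_le_sum_filter_pos (fun e => D.ς₁ / M.area e * M.area e) (Y K) hpen0)
  have hinn : ∀ K, inn K ≤ outflow D s uf K := fun K => add_le_add
    (sum_filter_neg_le_sum_mul (upwind s.uf s.c) (X K) hup0)
    (sum_filter_neg_le_sum_mul (fun e => D.ς₁ / M.area e * M.area e) (Y K) hpen0)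
  -- Positivity of the numerators is the ratio bound multiplied by c and |K|.
  have hn₁ : ∀ K, 0 < n₁ K := fun K => by
    have h : 0 < (s.φ K - φ K * (1 - (1 - D.F.β * s.c K) ^ 2 * D.δ₁)) * s.c K :=
      mul_pos (by linarith [hup K]) (hc K)
    exact mul_pos (by linarith) (vol_pos K)
  have hn₂ : ∀ K, 0 < n₂ K := fun K => by
    have h : 0 < (φ K * (1 + (1 - D.F.β * s.c K) ^ 2 * D.δ₂) - s.φ K) * s.c K :=
      mul_pos (by linarith [hlow K]) (hc K)
    exact mul_pos (by linarith) (vol_pos K)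
  have hd₁ : ∀ K, 0 < out K + D.ε := fun K => by linarith [hout0 K]
  have hd₂ : ∀ K, 0 < -inn K + D.ε := fun K => by linarith [hinn0 K]
  have hpos : 0 < timeStep D s φ uf := by
    rw [hts]
    obtain ⟨K, hK⟩ := exists_eq_ciInf_of_finite
      (f := fun K : M.Cell => min (n₁ K / (out K + D.ε)) (min (n₂ K / (-inn K + D.ε)) D.τmax))
    rw [← hK]
    exact lt_min (div_pos (hn₁ K) (hd₁ K)) (lt_min (div_pos (hn₂ K) (hd₂ K)) hτ)
  have hle : ∀ K, timeStep D s φ uf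
      ≤ min (n₁ K / (out K + D.ε)) (min (n₂ K / (-inn K + D.ε)) D.τmax) := fun K => by
    rw [hts]
    exact ciInf_le (Set.finite_range _).bddBelow K
  refine ⟨hpos, fun K => ⟨?_, ?_⟩⟩
  · have h := (le_div_iff₀ (hd₁ K)).1 ((hle K).trans (min_le_left _ _))
    refine le_trans ?_ h
    exact mul_le_mul_of_nonneg_left (by linarith [hout K]) hpos.le
  · have h := (le_div_iff₀ (hd₂ K)).1 ((hle K).trans ((min_le_right _ _).trans (min_le_left _ _)))
    refine le_trans ?_ h
    rw [← mul_neg]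
    exact mul_le_mul_of_nonneg_left (by linarith [hinn K]) hpos.le

/-- The mass balance on a cell. -/
theorem IsIteration.mass_cell {D : Data M} {s a a' : State M} (h : IsIteration D s a a')
    (hτ : 0 < timeStep D s a.φ a.uf) (K : M.Cell) :
    M.vol K * (a.φ K * a'.c K - s.φ K * s.c K)
      = -(timeStep D s a.φ a.uf * outflow D s a.uf K)
        - timeStep D s a.φ a.uf * (theta D.F D.δ₁ D.δ₂ s.c * D.F.R * D.F.T *
          ∑ e : M.IFace, D.ς₁ / M.area e * M.area e *
            (sgn K e * jumpQ (fun L => D.F.zeta (s.c L) (a'.c L)) e)) := by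
  have hm := h.mass (cellInd K)
  rw [innerQ_cellInd] at hm
  have h1 : ∀ e : M.IFace, ∫ x in M.faceSet e, upwind s.uf s.c e *
      inner ℝ (rtVal a.uf (M.fst e) x) (M.normal e) * jumpQ (cellInd K) e ∂μHE[d - 1]
      = upwind s.uf s.c e * (sgn K e * flux a.uf e) := by
    intro e
    rw [integral_mul_const, integral_const_mul, jumpQ_cellInd, flux]; ring
  have h2 : ∀ e : M.IFace, D.ς₁ / M.area e * ∫ _x in M.faceSet e,
      jumpQ (fun L => D.F.stabPot (theta D.F D.δ₁ D.δ₂ s.c) (s.c L) (a'.c L)) e *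
        jumpQ (cellInd K) e ∂μHE[d - 1]
      = D.ς₁ / M.area e * M.area e * (sgn K e * jumpQ (fun L => D.F.chemPot (s.c L)) e)
        + theta D.F D.δ₁ D.δ₂ s.c * D.F.R * D.F.T * (D.ς₁ / M.area e * M.area e *
            (sgn K e * jumpQ (fun L => D.F.zeta (s.c L) (a'.c L)) e)) := by
    intro e
    rw [setIntegral_face_const, jumpQ_cellInd]
    simp only [jumpQ, Fluid.stabPot]
    ring
  simp only [h1, h2, Finset.sum_add_distrib, ← Finset.mul_sum] at hm
  rw [mul_div_assoc', ← add_assoc, add_assoc, add_assoc, ← eq_neg_iff_add_eq_zero,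
    div_eq_iff hτ.ne'] at hm
  rw [hm, outflow]
  ring

theorem sgn_mul_jumpQ_nonneg {q : M.Q} {K : M.Cell} (hK : ∀ L, q L ≤ q K) (e : M.IFace) :
    0 ≤ sgn K e * jumpQ q e := by
  unfold sgn jumpQ
  split_ifs with h1 h2
  · rw [h1]; linarith [hK (M.snd e)]
  · rw [h2]; linarith [hK (M.fst e)]
  · simp

theorem sgn_mul_jumpQ_nonpos {q : M.Q} {K : M.Cell} (hK : ∀ L, q K ≤ q L) (e : M.IFace) :
    sgn K e * jumpQ q e ≤ 0 := by
  unfold sgn jumpQ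
  split_ifs with h1 h2
  · rw [h1]; linarith [hK (M.snd e)]
  · rw [h2]; linarith [hK (M.fst e)]
  · simp

/-- Discrete maximum principle for the stabilization variable. -/
theorem IsIteration.zeta_bounds {D : Data M} {s a a' : State M} (h : IsIteration D s a a')
    (hς : 0 < D.ς₁) (hε : 0 < D.ε) (hτ : 0 < D.τmax)
    (hc : ∀ K, 0 < s.c K ∧ D.F.β * s.c K < 1) (hφ : ∀ K, 0 < a.φ K)
    (hlow : ∀ K, s.φ K < a.φ K * (1 + (1 - D.F.β * s.c K) ^ 2 * D.δ₂))
    (hup : ∀ K, a.φ K * (1 - (1 - D.F.β * s.c K) ^ 2 * D.δ₁) < s.φ K) (K : M.Cell) :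
    -D.δ₁ ≤ D.F.zeta (s.c K) (a'.c K) ∧ D.F.zeta (s.c K) (a'.c K) ≤ D.δ₂ := by
  obtain ⟨hpos, hstep⟩ := timeStep_spec a.uf hς hε hτ (fun K => (hc K).1) hlow hup
  have hpen0 : ∀ e : M.IFace, 0 ≤ D.ς₁ / M.area e * M.area e := fun e =>
    mul_nonneg (div_nonneg hς.le (area_nonneg e)) (area_nonneg e)
  have hcoef : 0 ≤ theta D.F D.δ₁ D.δ₂ s.c * D.F.R * D.F.T :=
    mul_nonneg (mul_nonneg (zero_le_one.trans (one_le_theta _ _ _ _)) D.F.R_pos.le) D.F.T_pos.le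
  have hden : ∀ K, 0 < s.c K * (1 - D.F.β * s.c K) ^ 2 := fun K =>
    mul_pos (hc K).1 (pow_pos (by linarith [(hc K).2]) 2)
  constructor
  · obtain ⟨L, hL⟩ := Finite.exists_min fun L => D.F.zeta (s.c L) (a'.c L)
    refine le_trans ?_ (hL K)
    -- At a minimum of ζ every outward jump of ζ is nonpositive.
    have hdiff : timeStep D s a.φ a.uf * (theta D.F D.δ₁ D.δ₂ s.c * D.F.R * D.F.T *
        ∑ e : M.IFace, D.ς₁ / M.area e * M.area e *
          (sgn L e * jumpQ (fun L => D.F.zeta (s.c L) (a'.c L)) e)) ≤ 0 :=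
      mul_nonpos_of_nonneg_of_nonpos hpos.le (mul_nonpos_of_nonneg_of_nonpos hcoef
        (Finset.sum_nonpos fun e _ =>
          mul_nonpos_of_nonneg_of_nonpos (hpen0 e) (sgn_mul_jumpQ_nonpos hL e)))
    have hm := h.mass_cell hpos L
    have hs := (hstep L).1
    -- The old porosity cancels between the mass balance and the numerator of τ₁, leaving a common
    -- factor `a.φ L`.
    have hkey : 0 ≤ M.vol L * (a.φ L *
        (a'.c L - s.c L + D.δ₁ * (s.c L * (1 - D.F.β * s.c L) ^ 2))) := by linarith
    have hkey' := nonneg_of_mul_nonneg_right (nonneg_of_mul_nonneg_right hkey (vol_pos L)) (hφ L)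
    rw [Fluid.zeta, le_div_iff₀ (hden L)]
    linarith
  · obtain ⟨L, hL⟩ := Finite.exists_max fun L => D.F.zeta (s.c L) (a'.c L)
    refine (hL K).trans ?_
    have hdiff : 0 ≤ timeStep D s a.φ a.uf * (theta D.F D.δ₁ D.δ₂ s.c * D.F.R * D.F.T *
        ∑ e : M.IFace, D.ς₁ / M.area e * M.area e *
          (sgn L e * jumpQ (fun L => D.F.zeta (s.c L) (a'.c L)) e)) :=
      mul_nonneg hpos.le (mul_nonneg hcoef
        (Finset.sum_nonneg fun e _ => mul_nonneg (hpen0 e) (sgn_mul_jumpQ_nonneg hL e)))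
    have hm := h.mass_cell hpos L
    have hs := (hstep L).2
    have hkey : 0 ≤ M.vol L * (a.φ L *
        (s.c L - a'.c L + D.δ₂ * (s.c L * (1 - D.F.β * s.c L) ^ 2))) := by linarith
    have hkey' := nonneg_of_mul_nonneg_right (nonneg_of_mul_nonneg_right hkey (vol_pos L)) (hφ L)
    rw [Fluid.zeta, div_le_iff₀ (hden L)]
    linarith

/-! ### Pressure bounds and the porosity increment -/

theorem IsIteration.pressure_cell {D : Data M} {s a a' : State M} (h : IsIteration D s a a')
    (K : M.Cell) :
    a'.p K = D.F.stabPressure (theta D.F D.δ₁ D.δ₂ s.c) (s.c K) (a'.c K) := by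
  have hp := h.pressure (cellInd K)
  rw [innerQ_cellInd, innerQ_cellInd] at hp
  exact mul_left_cancel₀ (vol_pos K).ne' hp

/-- Every term is a difference quotient with the same positive time step, which therefore drops out:
the porosity increment is bounded without any lower bound on the step. -/
theorem IsIteration.porosity_cell {D : Data M} {s a a' : State M} (h : IsIteration D s a a')
    (hτ : 0 < timeStep D s a.φ a.uf) (K : M.Cell) :
    a'.φ K - s.φ K = 1 / D.N * (a'.p K - s.p K)
      + D.α * (M.vol K)⁻¹ * divPairing (cellInd K) (a'.us - s.us) := by
  classical
  have hp := h.porosity (cellInd K)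
  have hsum : ∀ v : M.V, innerQ (dvg v) (cellInd K)
      = ∑ L : M.Cell, M.vol L * (cellInd K L * dvg v L) := fun v => by
    simp only [innerQ, setIntegral_cell_const, mul_comm (dvg v _)]
  have hdiv := divPairing_smul (cellInd K) (timeStep D s a.φ a.uf)⁻¹ (a'.us - s.us)
  rw [divPairing, ← hsum] at hdiv
  rw [add_sub_assoc, ← mul_sub, hdiv, innerQ_cellInd, innerQ_cellInd] at hp
  have hv := (vol_pos K).ne'
  have hτ' := hτ.ne'
  generalize timeStep D s a.φ a.uf = τ at hp hτ'
  have : a'.φ K - s.φ K = (M.vol K)⁻¹ * τ * (M.vol K * ((a'.φ K - s.φ K) / τ)) := by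
    field_simp
  rw [this, hp]
  field_simp

theorem DensityRange.pos {F : Fluid} {ϱ₀ ϱ : ℝ} {c : M.Q} (h : DensityRange F ϱ₀ ϱ c)
    (hϱ₀ : 0 < ϱ₀) (K : M.Cell) : 0 < c K :=
  pos_of_mul_pos_right (hϱ₀.trans_le (h K).1) F.β_pos.le

theorem DensityRange.lt_one {F : Fluid} {ϱ₀ ϱ : ℝ} {c : M.Q} (h : DensityRange F ϱ₀ ϱ c)
    (hϱ : ϱ < 1) (K : M.Cell) : F.β * c K < 1 := (h K).2.trans_lt hϱ

theorem DensityRange.abs_stabPressure_le {F : Fluid} {δ₁ δ₂ ϱ₀ ϱ B Z : ℝ} {c c' : M.Q}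
    (h : DensityRange F ϱ₀ ϱ c) (hϱ₀ : 0 < ϱ₀) (hϱ : ϱ < 1) (hδ₁ : 0 < δ₁ ∧ δ₁ < 1)
    (hδ₂ : 0 < δ₂ ∧ δ₂ < 1)
    (hB : ∀ c, ϱ₀ ≤ F.β * c → F.β * c ≤ ϱ → |F.pressure c| ≤ B) (K : M.Cell)
    (hZ : |(c' K - c K) / (1 - F.β * c K) ^ 2| ≤ Z) :
    |F.stabPressure (theta F δ₁ δ₂ c) (c K) (c' K)| ≤ B + 2 / (1 - δ₁) * F.R * F.T * Z :=
  F.abs_stabPressure_le (h.pos hϱ₀ K).ne' (hB _ (h K).1 (h K).2)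
    (zero_le_one.trans (one_le_theta _ _ _ _))
    (theta_le hδ₁ hδ₂ fun L => ⟨mul_pos F.β_pos (h.pos hϱ₀ L), h.lt_one hϱ L⟩) hZ

/-- Both densities lie in (0, 1/β), so they differ by at most 1/β, while (1 - βc₀)² ≥ (1 - ϱ)². The
initial pressure obeys the stronger bound B. -/
theorem IsTimeLevel.abs_pressure_le {D : Data M} {ϱ₀ ϱ B : ℝ} {s : State M}
    (h : IsTimeLevel D ϱ₀ ϱ s) (hs : DensityRange D.F ϱ₀ ϱ s.c) (hϱ₀ : 0 < ϱ₀) (hϱ : ϱ < 1)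
    (hδ₁ : 0 < D.δ₁ ∧ D.δ₁ < 1) (hδ₂ : 0 < D.δ₂ ∧ D.δ₂ < 1)
    (hB : ∀ c, ϱ₀ ≤ D.F.β * c → D.F.β * c ≤ ϱ → |D.F.pressure c| ≤ B) (K : M.Cell) :
    |s.p K| ≤ B + 2 / (1 - D.δ₁) * D.F.R * D.F.T * (1 / (D.F.β * (1 - ϱ) ^ 2)) := by
  have hβ := D.F.β_pos
  have hd : 0 < 1 - D.δ₁ := by linarith
  have hq : 0 < 1 - ϱ := by linarith
  rcases h.pressure with hp | ⟨c₀, hc₀, hp⟩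
  · have hR := D.F.R_pos
    have hT := D.F.T_pos
    rw [hp K]
    refine (hB _ (hs K).1 (hs K).2).trans (le_add_of_nonneg_right (by positivity))
  · rw [hp K]
    refine hc₀.abs_stabPressure_le hϱ₀ hϱ hδ₁ hδ₂ hB K ?_
    have hden : (1 - ϱ) ^ 2 ≤ (1 - D.F.β * c₀ K) ^ 2 := by
      have := (hc₀ K).2
      gcongr
    have hnum : |s.c K - c₀ K| ≤ 1 / D.F.β := by
      rw [le_div_iff₀ hβ, show |s.c K - c₀ K| * D.F.β = |(s.c K - c₀ K) * D.F.β| by rw [abs_mul, abs_of_pos hβ], abs_le]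
      constructor <;> nlinarith [hc₀.lt_one hϱ K, hs.lt_one hϱ K, (hc₀ K).1, (hs K).1]
    rw [abs_div, abs_of_nonneg (sq_nonneg (1 - D.F.β * c₀ K))]
    calc _ ≤ (1 / D.F.β) / (1 - ϱ) ^ 2 := by gcongr
      _ = _ := by rw [div_div]

/-- The density bounds are equivalent to bounds of the stabilization variable. -/
theorem density_bounds_of_zeta {F : Fluid} {c c' δ₁ δ₂ : ℝ} (hc : 0 < c) (hy : F.β * c < 1)
    (hδ₁ : δ₁ < 1) (hδ₁' : 0 < δ₁) (hδ₂ : 0 < δ₂) (hδ₂' : δ₂ < 1)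
    (hζ : -δ₁ ≤ F.zeta c c' ∧ F.zeta c c' ≤ δ₂) :
    0 < (1 - δ₁ * (1 - F.β * c) ^ 2) * c ∧ (1 - δ₁ * (1 - F.β * c) ^ 2) * c ≤ c' ∧
      c' ≤ (1 + δ₂ * (1 - F.β * c) ^ 2) * c ∧ (1 + δ₂ * (1 - F.β * c) ^ 2) * c < 1 / F.β := by
  have hβ := F.β_pos
  have hy0 : 0 < F.β * c := mul_pos hβ hc
  have hden : 0 < c * (1 - F.β * c) ^ 2 := mul_pos hc (pow_pos (by linarith) 2)
  obtain ⟨h1, h2⟩ := hζ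
  rw [Fluid.zeta, le_div_iff₀ hden] at h1
  rw [Fluid.zeta, div_le_iff₀ hden] at h2
  refine ⟨mul_pos ?_ hc, by linarith, by linarith, ?_⟩
  · nlinarith
  · rw [lt_div_iff₀ hβ]
    -- The distance of χ₂βc from 1 factors, and y(1 - y) ≤ 1/4 makes both factors positive.
    have h3 : (1 + δ₂ * (1 - F.β * c) ^ 2) * c * F.β
        = 1 - (1 - F.β * c) * (1 - δ₂ * (F.β * c * (1 - F.β * c))) := by ring
    have h4 : δ₂ * (F.β * c * (1 - F.β * c)) < 1 := by nlinarith [sq_nonneg (F.β * c - 1 / 2)]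
    rw [h3]
    have := mul_pos (sub_pos.2 hy) (sub_pos.2 h4)
    linarith

/-- Porosities within `Cε` of the old one satisfy the ratio bound. -/
theorem ratio_bounds {y ϱ δ₁ δ₂ φmin Cε φ₀ φ : ℝ} (hy : y ≤ ϱ) (hy0 : 0 < y) (hϱ : ϱ < 1)
    (hδ₁ : 0 < δ₁ ∧ δ₁ < 1) (hδ₂ : 0 < δ₂) (hCε : 0 < Cε) (hφmin : 0 < φmin) (hφ₀ : φmin ≤ φ₀)
    (h₂ : Cε < (1 - ϱ) ^ 2 * δ₂ * φmin / (1 + (1 - ϱ) ^ 2 * δ₂))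
    (h₁ : Cε < (1 - ϱ) ^ 2 * δ₁ * φmin / (1 - (1 - ϱ) ^ 2 * δ₁))
    (hφ : φ₀ - Cε ≤ φ ∧ φ ≤ φ₀ + Cε) :
    0 < 1 - (1 - y) ^ 2 * δ₁ ∧ 0 < φ₀ - Cε ∧ φ₀ < φ * (1 + (1 - y) ^ 2 * δ₂) ∧
      φ * (1 - (1 - y) ^ 2 * δ₁) < φ₀ := by
  have hq : 0 < 1 - ϱ := by linarith
  have hsq : (1 - ϱ) ^ 2 ≤ (1 - y) ^ 2 := by gcongr
  have hsq0 : 0 < (1 - ϱ) ^ 2 := by positivity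
  have hsq1 : (1 - y) ^ 2 < 1 := by nlinarith
  generalize (1 - ϱ) ^ 2 = a at *
  generalize (1 - y) ^ 2 = b at *
  have ha₁ : 0 < 1 - a * δ₁ := by nlinarith [hδ₁.1, hδ₁.2]
  have hb₁ : 0 < 1 - b * δ₁ := by nlinarith [hδ₁.1, hδ₁.2]
  have ha₂ : 0 < 1 + a * δ₂ := by positivity
  rw [lt_div_iff₀ ha₁] at h₁
  rw [lt_div_iff₀ ha₂] at h₂
  have hpos : 0 < φ₀ - Cε := by nlinarith [mul_pos hsq0 hδ₂]
  have hφ0 : 0 < φ := hpos.trans_le hφ.1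
  -- The worst cases are φ₀ - Cε and φ₀ + Cε at y = ϱ, where the claims read Cε(1 + aδ₂) < aδ₂φ₀ and
  -- Cε(1 - aδ₁) < aδ₁φ₀. The assumptions state this with φmin in place of φ₀.
  have m₁ : a * δ₁ * φmin ≤ a * δ₁ * φ₀ :=
    mul_le_mul_of_nonneg_left hφ₀ (mul_pos hsq0 hδ₁.1).le
  have m₂ : a * δ₂ * φmin ≤ a * δ₂ * φ₀ :=
    mul_le_mul_of_nonneg_left hφ₀ (mul_pos hsq0 hδ₂).le
  refine ⟨hb₁, hpos, ?_, ?_⟩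
  · have h3 : φ * (1 + a * δ₂) ≤ φ * (1 + b * δ₂) := by
      have := hδ₂.le
      gcongr
    have h4 : (φ₀ - Cε) * (1 + a * δ₂) ≤ φ * (1 + a * δ₂) :=
      mul_le_mul_of_nonneg_right hφ.1 ha₂.le
    linarith
  · have h3 : φ * (1 - b * δ₁) ≤ φ * (1 - a * δ₁) := by
      have := hδ₁.1.le
      gcongr
    have h4 : φ * (1 - a * δ₁) ≤ (φ₀ + Cε) * (1 - a * δ₁) :=
      mul_le_mul_of_nonneg_right hφ.2 ha₁.le
    linarith

/-- The porosity increment is controlled by a pressure bound if `N` and `γ` are large. -/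
theorem IsIteration.abs_porosity_sub_le {D : Data M} {s a a' : State M}
    (h : IsIteration D s a a') (hτ : 0 < timeStep D s a.φ a.uf)
    (hs : ∀ v : M.V, formA D.α D.η D.γ D.ς₂ s.us s.p v = 0)
    (hcoer : ∀ (v : M.V) (p : M.Q),
      D.γ * brokenSq v ≤ formA D.α D.η D.γ D.ς₂ v p v + D.α * divPairing p v)
    {P Cε : ℝ} (hα : 0 < D.α) (hγ0 : 0 < D.γ) (hP : 0 < P) (hCε : 0 < Cε)
    (hp : ∀ K, |s.p K| ≤ P) (hp' : ∀ K, |a'.p K| ≤ P) (hN : 4 * P / Cε ≤ D.N)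
    (hγ : 32 * D.α ^ 2 * P * M.totalMeasure * (∑ K : M.Cell, (M.vol K)⁻¹) / Cε ≤ D.γ)
    (K : M.Cell) : |a'.φ K - s.φ K| ≤ Cε := by
  have hN0 : 0 < D.N := (by positivity : 0 < 4 * P / Cε).trans_le hN
  have hdp : ∀ K, |(a'.p - s.p) K| ≤ 2 * P := fun K => by
    have := abs_sub (a'.p K) (s.p K)
    rw [Pi.sub_apply]
    linarith [hp K, hp' K]
  -- Both levels satisfy the momentum balance, so their difference may be tested with the
  -- displacement increment itself.
  have hform : formA D.α D.η D.γ D.ς₂ (a'.us - s.us) (a'.p - s.p) (a'.us - s.us) = 0 := by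
    rw [formA_sub, h.momentum, hs, sub_zero]
  have hv := hcoer (a'.us - s.us) (a'.p - s.p)
  rw [hform, zero_add] at hv
  have hG := brokenL1_le_of_momentum hα hγ0 (by positivity : 0 < 2 * P) hdp hv
  have hB := abs_divPairing_le (abs_cellInd_le K) (a'.us - s.us)
  rw [one_mul] at hB
  have hI : (M.vol K)⁻¹ ≤ ∑ L : M.Cell, (M.vol L)⁻¹ :=
    Finset.single_le_sum (f := fun L : M.Cell => (M.vol L)⁻¹)
      (fun L _ => (inv_pos.2 (vol_pos L)).le) (Finset.mem_univ K)
  have hK0 : 0 < (M.vol K)⁻¹ := inv_pos.2 (vol_pos K)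
  -- The pressures differ by at most 2P, hence the constant 4P/Cε for N.
  have h1 : |1 / D.N * (a'.p K - s.p K)| ≤ Cε / 2 := by
    rw [abs_mul, abs_of_pos (by positivity : 0 < 1 / D.N), one_div, inv_mul_le_iff₀ hN0]
    rw [div_le_iff₀ hCε] at hN
    have := hdp K
    rw [Pi.sub_apply] at this
    linarith
  have h2 : |D.α * (M.vol K)⁻¹ * divPairing (cellInd K) (a'.us - s.us)| ≤ Cε / 2 := by
    rw [abs_mul, abs_of_pos (by positivity : 0 < D.α * (M.vol K)⁻¹)]
    have hI0 := hK0.le.trans hI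
    calc _ ≤ D.α * (∑ L : M.Cell, (M.vol L)⁻¹)
          * (8 * D.α * (2 * P) * M.totalMeasure / D.γ) :=
          mul_le_mul (mul_le_mul_of_nonneg_left hI hα.le) (hB.trans hG) (abs_nonneg _)
            (mul_nonneg hα.le hI0)
      _ = 32 * D.α ^ 2 * P * M.totalMeasure * (∑ L : M.Cell, (M.vol L)⁻¹) / D.γ / 2 := by ring
      _ ≤ Cε / 2 := by
          rw [div_le_iff₀ hCε, mul_comm D.γ] at hγ
          have := (div_le_iff₀ hγ0).2 hγ
          linarith
  rw [h.porosity_cell hτ K]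
  exact (abs_add_le _ _).trans (by linarith)

end Mesh
end PoroFlow

/-! ### Choice of the constants and induction over the iterates -/

open PoroFlow PoroFlow.Mesh in
theorem theorem4p3 (d : ℕ) (hd : 2 ≤ d) (F : Fluid) (α η δ₁ δ₂ ϱ₀ ϱ φmin φmax Cε : ℝ)
    (hα : 0 < α) (hη : 0 < η) (hδ₁ : 0 < δ₁ ∧ δ₁ < 1) (hδ₂ : 0 < δ₂ ∧ δ₂ < 1)
    (hϱ₀ : 0 < ϱ₀) (hϱ : ϱ < 1) (hφmin : 0 < φmin) (hφmax : φmax < 1) (hCε : 0 < Cε)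
    (hCε' : Cε < min ((1 - ϱ) ^ 2 * δ₂ * φmin / (1 + (1 - ϱ) ^ 2 * δ₂))
      (min ((1 - ϱ) ^ 2 * δ₁ * φmin / (1 - (1 - ϱ) ^ 2 * δ₁)) (1 - φmax))) :
    ∃ N₀ > 0, ∀ M : Mesh d, ∃ γ₀ > 0, ∃ κ > 0,
      ∀ D : Data M, D.F = F → D.α = α → D.η = η → D.δ₁ = δ₁ → D.δ₂ = δ₂ →
        0 < D.ς₁ → (∀ K, 0 < D.κ₀ K) → (∀ K, 0 < D.φr K ∧ D.φr K < 1) → 0 < D.ν →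
        0 < D.ε → 0 < D.τmax →
        N₀ ≤ D.N → γ₀ ≤ D.γ → κ * D.γ ≤ D.ς₂ →
      ∀ s : State M, IsTimeLevel D ϱ₀ ϱ s → DensityRange F ϱ₀ ϱ s.c →
        (∀ K, φmin ≤ s.φ K ∧ s.φ K ≤ φmax) →
      ∀ a : ℕ → State M, (a 0).φ = s.φ → IsRT0 (a 0).uf →
      ∀ l : ℕ, (∀ k ≤ l, IsIteration D s (a k) (a (k + 1))) → ∀ K : M.Cell,
        -- the ratio bound for the current iterate
        (1 / (1 + (1 - F.β * s.c K) ^ 2 * δ₂) < (a l).φ K / s.φ K ∧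
          (a l).φ K / s.φ K < 1 / (1 - (1 - F.β * s.c K) ^ 2 * δ₁)) ∧
        -- the density bound for the next iterate
        (0 < (1 - δ₁ * (1 - F.β * s.c K) ^ 2) * s.c K ∧
          (1 - δ₁ * (1 - F.β * s.c K) ^ 2) * s.c K ≤ (a (l + 1)).c K ∧
          (a (l + 1)).c K ≤ (1 + δ₂ * (1 - F.β * s.c K) ^ 2) * s.c K ∧
          (1 + δ₂ * (1 - F.β * s.c K) ^ 2) * s.c K < 1 / F.β) ∧
        -- the porosity bound for the next iterate
        (0 < s.φ K - Cε ∧ s.φ K - Cε ≤ (a (l + 1)).φ K ∧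
          (a (l + 1)).φ K ≤ s.φ K + Cε ∧ s.φ K + Cε < 1) := by
  obtain ⟨h₂, h₁, h₀⟩ : _ ∧ _ ∧ _ := ⟨(lt_min_iff.1 hCε').1, lt_min_iff.1 (lt_min_iff.1 hCε').2⟩
  obtain ⟨B, hB0, hB⟩ := F.exists_pressure_bound hϱ₀ hϱ
  have hβ := F.β_pos
  have hR := F.R_pos
  have hT := F.T_pos
  have hd₁ : 0 < 1 - δ₁ := by linarith
  have hq : 0 < 1 - ϱ := by linarith
  -- One bound for old and new pressures: 2/(1 - δ₁) bounds θ, and 1/(β(1 - ϱ)²) bounds (c' - c)/(1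
  -- - βc)² in both cases.
  obtain ⟨P, hPdef⟩ : ∃ P, P = B + 2 / (1 - δ₁) * F.R * F.T * (1 / (F.β * (1 - ϱ) ^ 2)) := ⟨_, rfl⟩
  have hP : 0 < P := by rw [hPdef]; positivity
  refine ⟨4 * P / Cε, by positivity, fun M => ?_⟩
  obtain ⟨κ, hκ, hcoer⟩ := M.exists_penalty_coercive
  have hW := M.totalMeasure_nonneg
  have hI : 0 ≤ ∑ K : M.Cell, (M.vol K)⁻¹ :=
    Finset.sum_nonneg fun K _ => (inv_pos.2 (vol_pos K)).le
  -- The first summand ensures 2η ≤ γ for coercivity; the second makes the displacement part of the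
  -- porosity increment at most Cε/2.
  refine ⟨2 * η + 32 * α ^ 2 * P * M.totalMeasure * (∑ K : M.Cell, (M.vol K)⁻¹) / Cε,
    by positivity, κ, hκ, ?_⟩
  rintro D rfl rfl rfl rfl rfl hς₁ - - - hε hτmax hN hγ hς₂ s hs hc hφ a ha0 - l hit
  have hγ2 : 2 * D.η ≤ D.γ := le_trans (le_add_of_nonneg_right (by positivity)) hγ
  have hγ3 := le_trans (le_add_of_nonneg_left (by positivity)) hγ
  have hγ0 : 0 < D.γ := by linarith
  have ratio := fun (φ : M.Q) (K : M.Cell) => ratio_bounds (φ := φ K) (hc K).2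
    (hϱ₀.trans_le (hc K).1) hϱ hδ₁ hδ₂.1 hCε hφmin (hφ K).1 h₂ h₁
  have step : ∀ k ≤ l, (∀ K, s.φ K - Cε ≤ (a k).φ K ∧ (a k).φ K ≤ s.φ K + Cε) →
      (∀ K, -D.δ₁ ≤ D.F.zeta (s.c K) ((a (k + 1)).c K) ∧
        D.F.zeta (s.c K) ((a (k + 1)).c K) ≤ D.δ₂) ∧
      ∀ K, s.φ K - Cε ≤ (a (k + 1)).φ K ∧ (a (k + 1)).φ K ≤ s.φ K + Cε := by
    intro k hk hak
    have hlow := fun K => (ratio _ K (hak K)).2.2.1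
    have hup := fun K => (ratio _ K (hak K)).2.2.2
    have hζ := (hit k hk).zeta_bounds hς₁ hε hτmax
      (fun K => ⟨hc.pos hϱ₀ K, hc.lt_one hϱ K⟩)
      (fun K => (ratio _ K (hak K)).2.1.trans_le (hak K).1) hlow hup
    refine ⟨hζ, fun K => ?_⟩
    have hτ := (timeStep_spec (a k).uf hς₁ hε hτmax (hc.pos hϱ₀) hlow hup).1
    have hp' : ∀ K, |(a (k + 1)).p K| ≤ P := by
      intro K
      rw [(hit k hk).pressure_cell K, hPdef]
      refine hc.abs_stabPressure_le hϱ₀ hϱ hδ₁ hδ₂ hB K ?_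
      have hcK := hc.pos hϱ₀ K
      -- The quotient is cζ with |ζ| ≤ 1, and c < 1/β ≤ 1/(β(1 - ϱ)²), so P serves here as well.
      have hdiv : ((a (k + 1)).c K - s.c K) / (1 - D.F.β * s.c K) ^ 2
          = s.c K * D.F.zeta (s.c K) ((a (k + 1)).c K) := by
        rw [Fluid.zeta, mul_div_assoc', mul_div_mul_left _ _ hcK.ne']
      have hζ1 : |D.F.zeta (s.c K) ((a (k + 1)).c K)| ≤ 1 :=
        abs_le.2 ⟨by linarith [(hζ K).1], by linarith [(hζ K).2]⟩
      have hϱ0 : 0 < ϱ := hϱ₀.trans_le ((hc K).1.trans (hc K).2)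
      rw [hdiv, abs_mul, abs_of_pos hcK, le_div_iff₀ (by positivity)]
      have h3 : s.c K * |D.F.zeta (s.c K) ((a (k + 1)).c K)| ≤ s.c K :=
        mul_le_of_le_one_right hcK.le hζ1
      have h4 : (1 - ϱ) ^ 2 ≤ 1 := pow_le_one₀ hq.le (by linarith)
      calc _ ≤ s.c K * (D.F.β * 1) := by gcongr
        _ ≤ 1 := by linarith [hc.lt_one hϱ K]
    have habs := (hit k hk).abs_porosity_sub_le hτ hs.momentum
      (hcoer D.α D.η D.γ D.ς₂ hη hγ2 hς₂) hα hγ0 hP hCε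
      (fun K => hPdef ▸ hs.abs_pressure_le hc hϱ₀ hϱ hδ₁ hδ₂ hB K) hp' hN hγ3 K
    obtain ⟨h3, h4⟩ := abs_le.1 habs
    exact ⟨by linarith, by linarith⟩
  have hphi : ∀ k ≤ l, ∀ K, s.φ K - Cε ≤ (a k).φ K ∧ (a k).φ K ≤ s.φ K + Cε := by
    intro k
    induction k with
    | zero => intro _ K; rw [ha0]; constructor <;> linarith
    | succ k ih => intro hk; exact (step k (by omega) (ih (by omega))).2
  intro K
  obtain ⟨hζ, hφ'⟩ := step l le_rfl (hphi l le_rfl)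
  obtain ⟨hr0, hr1, hr2, hr3⟩ := ratio _ K (hphi l le_rfl K)
  have hφ0 : 0 < s.φ K := by linarith
  have hδ₂' := hδ₂.1
  refine ⟨⟨?_, ?_⟩, ?_, hr1, (hφ' K).1, (hφ' K).2, by linarith [(hφ K).2]⟩
  · rw [div_lt_div_iff₀ (by positivity) hφ0, one_mul]; exact hr2
  · rw [div_lt_div_iff₀ hφ0 hr0, one_mul]; exact hr3
  · exact density_bounds_of_zeta (hc.pos hϱ₀ K) (hc.lt_one hϱ K) hδ₁.2 hδ₁.1 hδ₂.1 hδ₂.2 (hζ K)
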